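/- Let $A$ be a real $d\times d$ matrix all of whose (complex) eigenvalues have positive real parts, and put $t^A=\exp(A\log t)$ for $t>0$. Let $\rho:\mathbb R^d\to[0,\infty)$ be a continuous quasi-norm, i.e. $\rho(x)=0$ iff $x=0$, $\rho(-x)=\rho(x)$ and $\rho(x+y)\le K(\rho(x)+\rho(y))$ for some constant $K$, which is homogeneous: $\rho(t^Ax)=t\rho(x)$ for all $x\in\mathbb R^d$, $t>0$. Equip $\mathbb R^d$ with Lebesgue measure $|\cdot|$ and the quasi-metric $(x,y)\mapsto\rho(x-y)$, with respect to which balls $B(z,R)$, diameters and distances are taken. Let $\{Q^k_\alpha:k\in\mathbb Z,\ \alpha\in I_k\}$ be a collection of Christ's dyadic cubes, i.e. of open subsets of $\mathbb R^d$ such that for some constants $D>1$ and $\delta,\eta,C_1,C_2>0$: (i) $|\mathbb R^d\setminus\bigcup_{\alpha\in I_k}Q^k_\alpha|=0$ for all $k\in\mathbb Z$; (ii) if $l\le k$, then either $Q^l_\beta\subseteq Q^k_\alpha$ or $Q^l_\beta\cap Q^k_\alpha=\emptyset$; (iii) for each $(l,\beta)$ and each $k\ge l$ there is a unique $\alpha$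 with $Q^l_\beta\subseteq Q^k_\alpha$; (iv) each $Q^k_\alpha$ contains some ball $B(z^k_\alpha,\delta D^k)$, and $\operatorname{diam}(Q^k_\alpha)\le C_1D^k$; (v) $|\{x\in Q^k_\alpha:\operatorname{dist}(x,\mathbb R^d\setminus Q^k_\alpha)\le tD^k\}|\le C_2t^\eta|Q^k_\alpha|$ for all $(k,\alpha)$ and $t>0$. For a locally integrable $f:\mathbb R^d\to\mathbb C$ and $k\in\mathbb Z$ let $\mathbb E_kf$ be the conditional expectation of $f$ with respect to the $\sigma$-algebra $\mathcal F_k$ generated by all cubes $Q^l_\alpha$ with $l\ge -k$, that is, $\mathbb E_kf(x)=|Q|^{-1}\int_Qf(y)\,dy$, where $Q$ is the unique cube of level $-k$ containing $x$ (it exists for almost every $x$). For a sequence $(a_k:k\in\mathbb Z)$ of complex numbers put $$V_r(a_k:k\in\mathbb Z)=\sup_{k_0<k_1<\dots<k_J}\Big(\sum_{j=1}^J|a_{k_j}-a_{k_{j-1}}|^r\Big)^{1/r},$$ the supremum being taken over all finite increasing sequences of integers. Then for each $p\in(1,\infty)$ there is $C_p>0$ such that for all $r\in(2,\infty)$ and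 all $f\in L^p(\mathbb R^d)$ $$\big\|V_r(\mathbb E_kf:k\in\mathbb Z)\big\|_{L^p}\le C_p\,\frac{r}{r-2}\,\|f\|_{L^p}.$$ Moreover, $f\mapsto V_r(\mathbb E_kf:k\in\mathbb Z)$ is of weak type $(1,1)$: for each $r\in(2,\infty)$ there is $C_r>0$ such that for all $f\in L^1(\mathbb R^d)$ and $\lambda>0$ $$\big|\{x\in\mathbb R^d:V_r(\mathbb E_kf(x):k\in\mathbb Z)>\lambda\}\big|\le\frac{C_r}{\lambda}\,\|f\|_{L^1}.$$ (The constants $C_p$, $C_r$ may depend on the fixed data $d$, $A$, $\rho$ and the collection of cubes.) -/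

import Mathlib

open MeasureTheory
open scoped ENNReal

noncomputable section

/-- The dilation `t ^ A = exp (A log t)` acting on `ℝ^d`. -/
def dilation {d : ℕ} (A : Matrix (Fin d) (Fin d) ℝ) (t : ℝ) (x : EuclideanSpace ℝ (Fin d)) :
    EuclideanSpace ℝ (Fin d) :=
  Matrix.toEuclideanLin (NormedSpace.exp (Real.log t • A)) x

/-- `A` generates a dilation group: all its complex eigenvalues have positive real part. -/
def IsDilationGenerator {d : ℕ} (A : Matrix (Fin d) (Fin d) ℝ) : Prop :=
  ∀ μ ∈ spectrum ℂ (A.map ((↑) : ℝ → ℂ)), 0 < μ.re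

/-- `ρ` is a continuous quasi-norm on `ℝ^d`, homogeneous with respect to the dilations `t ^ A`. -/
structure IsHomogeneousQuasiNorm {d : ℕ} (A : Matrix (Fin d) (Fin d) ℝ)
    (ρ : EuclideanSpace ℝ (Fin d) → ℝ) : Prop where
  continuous : Continuous ρ
  nonneg : ∀ x, 0 ≤ ρ x
  eq_zero_iff : ∀ x, ρ x = 0 ↔ x = 0
  neg : ∀ x, ρ (-x) = ρ x
  quasi_triangle : ∃ K : ℝ, ∀ x y, ρ (x + y) ≤ K * (ρ x + ρ y)
  homogeneous : ∀ t : ℝ, 0 < t → ∀ x, ρ (dilation A t x) = t * ρ x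

/-- The ball of the quasi-metric `(x, y) ↦ ρ (x - y)`. -/
def quasiBall {d : ℕ} (ρ : EuclideanSpace ℝ (Fin d) → ℝ) (z : EuclideanSpace ℝ (Fin d)) (R : ℝ) :
    Set (EuclideanSpace ℝ (Fin d)) :=
  {x | ρ (x - z) < R}

/-- The diameter of a set in the quasi-metric `(x, y) ↦ ρ (x - y)`. -/
def quasiDiam {d : ℕ} (ρ : EuclideanSpace ℝ (Fin d) → ℝ) (s : Set (EuclideanSpace ℝ (Fin d))) :
    ℝ≥0∞ :=
  ⨆ x ∈ s, ⨆ y ∈ s, ENNReal.ofReal (ρ (x - y))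

/-- The distance of a point to a set in the quasi-metric `(x, y) ↦ ρ (x - y)`
(`∞` if the set is empty). -/
def quasiInfDist {d : ℕ} (ρ : EuclideanSpace ℝ (Fin d) → ℝ) (x : EuclideanSpace ℝ (Fin d))
    (s : Set (EuclideanSpace ℝ (Fin d))) : ℝ≥0∞ :=
  ⨅ y ∈ s, ENNReal.ofReal (ρ (x - y))

/-- The sets `Q k α` (`k ∈ ℤ`, `α ∈ ι k`) form a system of Christ's dyadic cubes for the
quasi-metric induced by `ρ` and Lebesgue measure; the cubes of level `k` have size about `D ^ k`. -/
def IsDyadicCubeSystem {d : ℕ} (ρ : EuclideanSpace ℝ (Fin d) → ℝ) {ι : ℤ → Type*}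
    (Q : (k : ℤ) → ι k → Set (EuclideanSpace ℝ (Fin d))) : Prop :=
  (∀ k α, IsOpen (Q k α)) ∧
  ∃ D δ η C₁ C₂ : ℝ, 1 < D ∧ 0 < δ ∧ 0 < η ∧ 0 < C₁ ∧ 0 < C₂ ∧
    (∀ k, volume (⋃ α, Q k α)ᶜ = 0) ∧
    (∀ l k, l ≤ k → ∀ (β : ι l) (α : ι k), Q l β ⊆ Q k α ∨ Disjoint (Q l β) (Q k α)) ∧
    (∀ l k, l ≤ k → ∀ β : ι l, ∃! α : ι k, Q l β ⊆ Q k α) ∧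
    (∀ k α, (∃ z, quasiBall ρ z (δ * D ^ k) ⊆ Q k α) ∧
      quasiDiam ρ (Q k α) ≤ ENNReal.ofReal (C₁ * D ^ k)) ∧
    (∀ k α, ∀ t : ℝ, 0 < t →
      volume {x ∈ Q k α | quasiInfDist ρ x (Q k α)ᶜ ≤ ENNReal.ofReal (t * D ^ k)} ≤
        ENNReal.ofReal (C₂ * t ^ η) * volume (Q k α))

/-- `𝔼_k f (x)`, the conditional expectation of `f` at `x` given the `σ`-algebra generated by the
cubes of level at least `-k`: the average of `f` over the cube of level `-k` that contains `x`
(and `0` for the null set of `x` in no such cube). At most one term of the sum is nonzero,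
because the cubes of a given level are pairwise disjoint. -/
def dyadicExpectation {d : ℕ} {ι : ℤ → Type*}
    (Q : (k : ℤ) → ι k → Set (EuclideanSpace ℝ (Fin d)))
    (f : EuclideanSpace ℝ (Fin d) → ℂ) (k : ℤ) (x : EuclideanSpace ℝ (Fin d)) : ℂ :=
  ∑' α : ι (-k), (Q (-k) α).indicator (fun _ => ⨍ y in Q (-k) α, f y) x

/-- The `r`-variation seminorm of a sequence indexed by `ℤ`, with values in `[0, ∞]`. -/
def rVariation (r : ℝ) (a : ℤ → ℂ) : ℝ≥0∞ :=
  ⨆ (J : ℕ) (k : Fin (J + 1) → ℤ) (_ : StrictMono k),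
    (∑ j : Fin J, ‖a (k j.succ) - a (k j.castSucc)‖ₑ ^ r) ^ (1 / r)

/-- The function `x ↦ V_r (𝔼_k f (x) : k ∈ ℤ)`. -/
def dyadicVariation {d : ℕ} {ι : ℤ → Type*}
    (Q : (k : ℤ) → ι k → Set (EuclideanSpace ℝ (Fin d))) (r : ℝ)
    (f : EuclideanSpace ℝ (Fin d) → ℂ) (x : EuclideanSpace ℝ (Fin d)) : ℝ≥0∞ :=
  rVariation r (fun k => dyadicExpectation Q f k x)

end

/-!
The averages of `f` over the cubes form a martingale, and the statement is Lépingle's inequality for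
it, with control of the constant as `r → 2`. The geometry enters only through two facts about the
cubes: they have finite measure, and a cube is at most a constant times larger than the cubes one
level below it (`IsDyadicCubeSystem.exists_volume_le`). Both come from the homogeneity of `ρ`: a
dilation maps balls to balls and multiplies all measures by its determinant, and `ρ` is bounded away
from zero outside the unit ball.

The heart is the weak type `(1, 1)` inequality with a constant of size `r / (r - 2)`
(`IsCellFiltration.measure_lt_seqVar_le`). To bound the set where the variation exceeds `s`, the
martingale is stopped when the averages of `‖f‖` exceed a small multiple of `s`; this changes it
only on a set controlled by the maximal inequality, and since the measures of successive cells are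
comparable, the stopped martingale `G` is bounded by `s / 2`. For each `m`, let `G` be sampled at
its successive jumps of size comparable to `2 ^ (-m) * s`. An increment of `G` of size about
`2 ^ (-m) * s` forces a jump of the `m`-th sampled martingale, so that the `r`-th power of the
variation is, up to a constant, at most the sum over `m` of `(2 ^ (-m) * s) ^ (r - 2)` times the
square functions of the sampled martingales (`seqVar_rpow_le`). By orthogonality
these have integral at most `‖G‖₂ ^ 2 ≤ (s / 2) * ‖f‖₁`
(`IsCellFiltration.lintegral_sum_sq_jumpSample_le`), and the geometric series over `m` produces the factor `r / (r - 2)`.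

The `L^p` bounds for all `1 < p < ∞` follow from a good-`λ` inequality
(`IsCellFiltration.measure_goodLambda_le`): after the first time at which the variation exceeds `λ`,
the weak type inequality is applied inside the cell of that time, so that the weak type constant `W`
gives a bound of the `L^p` norm of the variation by `C_p * W` times that of the maximal function,
and Doob's inequality (`IsCellFiltration.lintegral_maxAvg_rpow_le`) concludes. All this is carried
out for abstract filtrations indexed by `ℕ`; the cubes of level at most `N` give such a filtration,
starting at level `N`, and `N` tends to infinity at the end.
-/

/-! ### The `r`-variation of a sequence -/

/-- The `r`-variation of a sequence indexed by `ℕ`. The supremum is over monotone, not strictly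
monotone, index sequences: repetitions contribute nothing, and monotonicity is preserved when
sequences are stopped or reindexed. -/
noncomputable def seqVar (r : ℝ) (a : ℕ → ℂ) : ℝ≥0∞ :=
  ⨆ (J : ℕ) (u : {u : ℕ → ℕ // Monotone u}),
    (∑ i ∈ Finset.range J, ‖a (u.1 (i + 1)) - a (u.1 i)‖ₑ ^ r) ^ (1 / r)

theorem seqVar_le {r : ℝ} {a : ℕ → ℂ} {B : ℝ≥0∞}
    (h : ∀ (J : ℕ) (u : ℕ → ℕ), Monotone u →
      (∑ i ∈ Finset.range J, ‖a (u (i + 1)) - a (u i)‖ₑ ^ r) ^ (1 / r) ≤ B) :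
    seqVar r a ≤ B :=
  iSup_le fun J => iSup_le fun u => h J u.1 u.2

theorem le_seqVar (r : ℝ) (a : ℕ → ℂ) (J : ℕ) {u : ℕ → ℕ} (hu : Monotone u) :
    (∑ i ∈ Finset.range J, ‖a (u (i + 1)) - a (u i)‖ₑ ^ r) ^ (1 / r) ≤ seqVar r a :=
  le_iSup_of_le J (le_iSup_of_le ⟨u, hu⟩ le_rfl)

theorem seqVar_comp_le (r : ℝ) (a : ℕ → ℂ) {φ : ℕ → ℕ} (hφ : Monotone φ) :
    seqVar r (fun n => a (φ n)) ≤ seqVar r a :=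
  seqVar_le fun J u hu => le_seqVar r a J (u := fun i => φ (u i)) fun _ _ h => hφ (hu h)

theorem seqVar_add_le {r : ℝ} (hr : 1 ≤ r) (a b : ℕ → ℂ) :
    seqVar r (fun n => a n + b n) ≤ seqVar r a + seqVar r b := by
  refine seqVar_le fun J u hu => ?_
  have hr0 : 0 < r := by linarith
  calc (∑ i ∈ Finset.range J,
        ‖(a (u (i + 1)) + b (u (i + 1))) - (a (u i) + b (u i))‖ₑ ^ r) ^ (1 / r)
      ≤ (∑ i ∈ Finset.range J,
          (‖a (u (i + 1)) - a (u i)‖ₑ + ‖b (u (i + 1)) - b (u i)‖ₑ) ^ r) ^ (1 / r) := by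
        gcongr with i
        rw [add_sub_add_comm]
        exact enorm_add_le _ _
    _ ≤ _ := ENNReal.Lp_add_le _ _ _ hr
    _ ≤ _ := add_le_add (le_seqVar r a J hu) (le_seqVar r b J hu)

theorem seqVar_const {r : ℝ} (hr : 1 ≤ r) (z : ℂ) : seqVar r (fun _ => z) = 0 := by
  have hr0 : 0 < r := by linarith
  refine le_antisymm (seqVar_le fun J u _ => ?_) zero_le
  simp [ENNReal.zero_rpow_of_pos hr0, hr0]

theorem seqVar_step_le {r : ℝ} (hr : 1 ≤ r) (m : ℕ) (z : ℂ) :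
    seqVar r (fun n => if m ≤ n then z else 0) ≤ ‖z‖ₑ := by
  have hr0 : 0 < r := by linarith
  refine seqVar_le fun J u hu => ?_
  have key : ∀ J, ∑ i ∈ Finset.range J,
      ‖(if m ≤ u (i + 1) then z else 0) - (if m ≤ u i then z else 0)‖ₑ ^ r
        ≤ if m ≤ u J then ‖z‖ₑ ^ r else 0 := by
    intro J
    induction J with
    | zero => simp
    | succ J ih =>
      rw [Finset.sum_range_succ]
      have hJ : u J ≤ u (J + 1) := hu (Nat.le_succ J)
      by_cases h1 : m ≤ u J
      · have h2 : m ≤ u (J + 1) := h1.trans hJ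
        simpa [h1, h2, ENNReal.zero_rpow_of_pos hr0] using ih
      · simp only [h1, if_false, nonpos_iff_eq_zero] at ih ⊢
        rw [ih]
        by_cases h2 : m ≤ u (J + 1) <;> simp [h2, ENNReal.zero_rpow_of_pos hr0]
  calc _ ≤ (‖z‖ₑ ^ r) ^ (1 / r) := by
        gcongr
        refine (key J).trans ?_
        split_ifs
        · exact le_rfl
        · exact zero_le
    _ = ‖z‖ₑ := by rw [← ENNReal.rpow_mul, mul_one_div_cancel hr0.ne', ENNReal.rpow_one]

/-- The variation up to time `L` is at most the variation up to time `m`, plus the jump at time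
`m + 1`, plus the variation between the times `m + 1` and `L`. -/
theorem seqVar_min_le_split {r : ℝ} (hr : 1 ≤ r) (a : ℕ → ℂ) {m L : ℕ} (hm : m + 1 ≤ L) :
    seqVar r (fun n => a (min n L)) ≤ seqVar r (fun n => a (min n m)) + ‖a (m + 1) - a m‖ₑ +
      seqVar r (fun n => a (max (m + 1) (min n L))) := by
  have h : (fun n => a (min n L)) = fun n => (a (min n m) +
      (if m + 1 ≤ n then a (m + 1) - a m else 0)) +
      (a (max (m + 1) (min n L)) + -a (m + 1)) := by
    funext n
    by_cases hn : m + 1 ≤ n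
    · rw [if_pos hn, min_eq_right (by omega : m ≤ n), max_eq_right (by omega)]
      ring
    · rw [if_neg hn, min_eq_left (by omega : n ≤ m), min_eq_left (by omega : n ≤ L),
        max_eq_left (by omega)]
      ring
  rw [h]
  refine (seqVar_add_le hr _ _).trans (add_le_add ((seqVar_add_le hr _ _).trans ?_) ?_)
  · exact add_le_add le_rfl (seqVar_step_le hr _ _)
  · refine (seqVar_add_le hr _ _).trans ?_
    rw [seqVar_const hr, add_zero]

theorem seqVar_min_zero {r : ℝ} (hr : 1 ≤ r) (a : ℕ → ℂ) :
    seqVar r (fun n => a (min n 0)) = 0 := by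
  simpa using seqVar_const hr (a 0)

theorem seqVar_min_le_sum {r : ℝ} (hr : 1 ≤ r) (a : ℕ → ℂ) (L : ℕ) :
    seqVar r (fun n => a (min n L)) ≤ ∑ i ∈ Finset.range L, ‖a (i + 1) - a i‖ₑ := by
  induction L with
  | zero => rw [seqVar_min_zero hr]; simp
  | succ L ih =>
    rw [Finset.sum_range_succ]
    refine (seqVar_min_le_split hr a le_rfl).trans ?_
    have : (fun n => a (max (L + 1) (min n (L + 1)))) = fun _ => a (L + 1) := by
      funext n
      rw [max_eq_left (min_le_right _ _)]
    rw [this, seqVar_const hr, add_zero]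
    gcongr

theorem seqVar_min_mono (r : ℝ) (a : ℕ → ℂ) {m n : ℕ} (h : m ≤ n) :
    seqVar r (fun k => a (min k m)) ≤ seqVar r (fun k => a (min k n)) := by
  have := seqVar_comp_le r (fun k => a (min k n)) (φ := fun k => min k m)
    (fun _ _ h => min_le_min_right _ h)
  simpa [min_assoc, min_eq_left h] using this

/-! ### Sampling a sequence at its jumps -/

/-- The sequence `a` sampled at its successive jumps of size at least `t`: the value is kept until
`a` has moved away from it by at least `t`, and is then replaced by the current value of `a`. -/
noncomputable def jumpSample (t : ℝ) (a : ℕ → ℂ) : ℕ → ℂ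
  | 0 => a 0
  | n + 1 => if t ≤ ‖a (n + 1) - jumpSample t a n‖ then a (n + 1) else jumpSample t a n

theorem norm_sub_jumpSample_lt {t : ℝ} (ht : 0 < t) (a : ℕ → ℂ) (n : ℕ) :
    ‖a n - jumpSample t a n‖ < t := by
  cases n with
  | zero => simpa [jumpSample] using ht
  | succ n =>
    simp only [jumpSample]
    split_ifs with h
    · simpa using ht
    · exact not_le.mp h

theorem jumpSample_succ_eq_or (t : ℝ) (a : ℕ → ℂ) (n : ℕ) :
    jumpSample t a (n + 1) = jumpSample t a n ∨
      t ≤ ‖jumpSample t a (n + 1) - jumpSample t a n‖ := by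
  simp only [jumpSample]
  split_ifs with h
  · exact Or.inr h
  · exact Or.inl rfl

theorem norm_jumpSample_le {t B : ℝ} {a : ℕ → ℂ} (h : ∀ n, ‖a n‖ ≤ B) (n : ℕ) :
    ‖jumpSample t a n‖ ≤ B := by
  induction n with
  | zero => exact h 0
  | succ n ih =>
    simp only [jumpSample]
    split_ifs
    · exact h _
    · exact ih

/-- An oscillation of `a` of size about `t` forces the sampled sequence to jump in between. -/
theorem exists_jump_of_four_mul_le {t : ℝ} (ht : 0 < t) (a : ℕ → ℂ) {i j : ℕ} (hij : i ≤ j)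
    (h : 4 * t ≤ ‖a j - a i‖) :
    ∃ n ∈ Finset.Ico i j, t ≤ ‖jumpSample t a (n + 1) - jumpSample t a n‖ := by
  by_contra! hcon
  have hconst : ∀ k, i + k ≤ j → jumpSample t a (i + k) = jumpSample t a i := by
    intro k
    induction k with
    | zero => simp
    | succ k ih =>
      intro hk
      rw [← ih (by omega), ← add_assoc]
      refine (jumpSample_succ_eq_or t a (i + k)).resolve_right (not_le.mpr ?_)
      exact hcon _ (Finset.mem_Ico.mpr ⟨by omega, by omega⟩)
  have h1 := hconst (j - i) (by omega)
  rw [Nat.add_sub_cancel' hij] at h1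
  have h2 := norm_sub_jumpSample_lt ht a j
  have h3 := norm_sub_jumpSample_lt ht a i
  have h4 : a j - a i = (a j - jumpSample t a j) - (a i - jumpSample t a i) := by rw [h1]; ring
  have h5 := norm_sub_le (a j - jumpSample t a j) (a i - jumpSample t a i)
  rw [← h4] at h5
  linarith

/-- A jump of the sampled sequence at level `t` has size at least `t`, hence it accounts for the
square of an increment of size at most `8 * t` up to the factor `64`. -/
theorem enorm_sub_rpow_le {r t : ℝ} (hr : 2 ≤ r) (ht : 0 < t) (a : ℕ → ℂ) {i j : ℕ} (hij : i ≤ j)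
    (h : 4 * t ≤ ‖a j - a i‖) (h' : ‖a j - a i‖ ≤ 8 * t) :
    ‖a j - a i‖ₑ ^ r ≤ 64 * (ENNReal.ofReal ((8 * t) ^ (r - 2)) *
      ∑ n ∈ Finset.Ico i j, ‖jumpSample t a (n + 1) - jumpSample t a n‖ₑ ^ 2) := by
  obtain ⟨n, hn, hjump⟩ := exists_jump_of_four_mul_le ht a hij h
  have hpos : 0 < ‖a j - a i‖ := by linarith
  have hle : ‖a j - a i‖ ^ r ≤ (8 * t) ^ (r - 2) *
      (64 * ‖jumpSample t a (n + 1) - jumpSample t a n‖ ^ 2) := by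
    have : ‖a j - a i‖ ^ r = ‖a j - a i‖ ^ (r - 2) * ‖a j - a i‖ ^ 2 := by
      rw [← Real.rpow_natCast, ← Real.rpow_add hpos]; norm_num
    rw [this]
    have h1 : ‖a j - a i‖ ^ (r - 2) ≤ (8 * t) ^ (r - 2) :=
      Real.rpow_le_rpow hpos.le h' (by linarith)
    have h2 : ‖a j - a i‖ ^ 2 ≤ 64 * ‖jumpSample t a (n + 1) - jumpSample t a n‖ ^ 2 := by
      nlinarith [norm_nonneg (a j - a i)]
    exact mul_le_mul h1 h2 (by positivity) (by positivity)
  calc ‖a j - a i‖ₑ ^ r = ENNReal.ofReal (‖a j - a i‖ ^ r) := by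
        rw [← ofReal_norm, ENNReal.ofReal_rpow_of_pos hpos]
    _ ≤ ENNReal.ofReal ((8 * t) ^ (r - 2) *
          (64 * ‖jumpSample t a (n + 1) - jumpSample t a n‖ ^ 2)) := ENNReal.ofReal_le_ofReal hle
    _ = 64 * (ENNReal.ofReal ((8 * t) ^ (r - 2)) *
          ‖jumpSample t a (n + 1) - jumpSample t a n‖ₑ ^ 2) := by
        rw [ENNReal.ofReal_mul (by positivity), ENNReal.ofReal_mul (by norm_num),
          ENNReal.ofReal_pow (norm_nonneg _), ofReal_norm]
        norm_num
        ring
    _ ≤ _ := by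
        gcongr
        exact Finset.single_le_sum
          (f := fun n => ‖jumpSample t a (n + 1) - jumpSample t a n‖ₑ ^ 2) (fun _ _ => zero_le) hn

theorem sum_sum_Ico_le_tsum {u : ℕ → ℕ} (hu : Monotone u) (s : ℕ → ℝ≥0∞) (J : ℕ) :
    ∑ i ∈ Finset.range J, ∑ n ∈ Finset.Ico (u i) (u (i + 1)), s n ≤ ∑' n, s n := by
  have : ∑ i ∈ Finset.range J, ∑ n ∈ Finset.Ico (u i) (u (i + 1)), s n =
      ∑ n ∈ Finset.Ico (u 0) (u J), s n := by
    induction J with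
    | zero => simp
    | succ J ih =>
      rw [Finset.sum_range_succ, ih]
      exact Finset.sum_Ico_consecutive _ (hu (Nat.zero_le _)) (hu (Nat.le_succ _))
  rw [this]
  exact ENNReal.sum_le_tsum _

/-- Pathwise bound of the `r`-variation of a bounded sequence by square functions of the sequence
sampled at its jumps of size at least `2 ^ (-m) B / 4`, `m ∈ ℕ`: an increment of size about
`2 ^ (-m) B` is seen by the `m`-th sampled sequence. -/
theorem seqVar_rpow_le {r B : ℝ} (hr : 2 < r) (hB : 0 < B) {a : ℕ → ℂ} (ha : ∀ n, ‖a n‖ ≤ B) :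
    seqVar r a ^ r ≤ 64 * ∑' m : ℕ, ENNReal.ofReal ((2 * B * (1 / 2) ^ m) ^ (r - 2)) *
      ∑' n, ‖jumpSample (B * (1 / 2) ^ m / 4) a (n + 1) -
        jumpSample (B * (1 / 2) ^ m / 4) a n‖ₑ ^ 2 := by
  have hr0 : 0 < r := by linarith
  rw [← ENNReal.le_rpow_inv_iff hr0, ← one_div]
  refine seqVar_le fun J u hu => ?_
  gcongr
  have key : ∀ i, ‖a (u (i + 1)) - a (u i)‖ₑ ^ r ≤ 64 * ∑' m : ℕ,
      ENNReal.ofReal ((2 * B * (1 / 2) ^ m) ^ (r - 2)) * ∑ n ∈ Finset.Ico (u i) (u (i + 1)),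
        ‖jumpSample (B * (1 / 2) ^ m / 4) a (n + 1) -
          jumpSample (B * (1 / 2) ^ m / 4) a n‖ₑ ^ 2 := by
    intro i
    by_cases h0 : a (u (i + 1)) - a (u i) = 0
    · simp [h0, ENNReal.zero_rpow_of_pos hr0]
    have hpos : 0 < ‖a (u (i + 1)) - a (u i)‖ := norm_pos_iff.mpr h0
    have hle : ‖a (u (i + 1)) - a (u i)‖ ≤ 2 * B := by
      refine (norm_sub_le _ _).trans ?_
      linarith [ha (u (i + 1)), ha (u i)]
    obtain ⟨m, hm1, hm2⟩ := exists_nat_pow_near_of_lt_one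
      (x := ‖a (u (i + 1)) - a (u i)‖ / (2 * B)) (y := 1 / 2) (by positivity)
      (by rw [div_le_one (by positivity)]; exact hle) (by norm_num) (by norm_num)
    rw [lt_div_iff₀ (by positivity), pow_succ] at hm1
    rw [div_le_iff₀ (by positivity)] at hm2
    have ht : 0 < B * (1 / 2) ^ m / 4 := by positivity
    have h8 : 8 * (B * (1 / 2) ^ m / 4) = 2 * B * (1 / 2) ^ m := by ring
    refine (enorm_sub_rpow_le hr.le ht a (hu (Nat.le_succ i)) (by linarith)
      (by linarith)).trans ?_
    rw [h8]
    gcongr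
    exact ENNReal.le_tsum (f := fun m : ℕ => ENNReal.ofReal ((2 * B * (1 / 2) ^ m) ^ (r - 2)) *
      ∑ n ∈ Finset.Ico (u i) (u (i + 1)), ‖jumpSample (B * (1 / 2) ^ m / 4) a (n + 1) -
        jumpSample (B * (1 / 2) ^ m / 4) a n‖ₑ ^ 2) m
  calc ∑ i ∈ Finset.range J, ‖a (u (i + 1)) - a (u i)‖ₑ ^ r
      ≤ ∑ i ∈ Finset.range J, 64 * ∑' m : ℕ,
      ENNReal.ofReal ((2 * B * (1 / 2) ^ m) ^ (r - 2)) * ∑ n ∈ Finset.Ico (u i) (u (i + 1)),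
        ‖jumpSample (B * (1 / 2) ^ m / 4) a (n + 1) -
          jumpSample (B * (1 / 2) ^ m / 4) a n‖ₑ ^ 2 := Finset.sum_le_sum fun i _ => key i
    _ = 64 * ∑' m : ℕ, ENNReal.ofReal ((2 * B * (1 / 2) ^ m) ^ (r - 2)) *
      ∑ i ∈ Finset.range J, ∑ n ∈ Finset.Ico (u i) (u (i + 1)),
        ‖jumpSample (B * (1 / 2) ^ m / 4) a (n + 1) -
          jumpSample (B * (1 / 2) ^ m / 4) a n‖ₑ ^ 2 := by
        rw [← Finset.mul_sum, ← Summable.tsum_finsetSum (fun _ _ => ENNReal.summable)]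
        simp_rw [Finset.mul_sum]
    _ ≤ _ := by
        gcongr with m
        exact sum_sum_Ico_le_tsum hu _ J

/-- Both when the sampled sequence jumps and when it does not, passing from `n` to `n + 1` changes
the left-hand side by `‖a (n + 1) - b‖ ^ 2 - ‖a n - b‖ ^ 2`, where `b` is the `n`-th sampled
value. -/
theorem sum_sq_jumpSample_eq (t : ℝ) (a : ℕ → ℂ) (n : ℕ) :
    ∑ i ∈ Finset.range n, ‖jumpSample t a (i + 1) - jumpSample t a i‖ ^ 2 +
        ‖a n - jumpSample t a n‖ ^ 2 =
      ‖a n‖ ^ 2 - ‖a 0‖ ^ 2 -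
        2 * ∑ i ∈ Finset.range n, (starRingEnd ℂ (jumpSample t a i) * (a (i + 1) - a i)).re := by
  induction n with
  | zero => simp [jumpSample]
  | succ n ih =>
    have hsq : ∀ z w : ℂ, ‖z - w‖ ^ 2 = ‖z‖ ^ 2 + ‖w‖ ^ 2 - 2 * (starRingEnd ℂ w * z).re := by
      intro z w
      rw [← Complex.normSq_eq_norm_sq, ← Complex.normSq_eq_norm_sq, ← Complex.normSq_eq_norm_sq,
        Complex.normSq_sub, mul_comm z]
    have key : ‖jumpSample t a (n + 1) - jumpSample t a n‖ ^ 2 +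
        ‖a (n + 1) - jumpSample t a (n + 1)‖ ^ 2 = ‖a (n + 1) - jumpSample t a n‖ ^ 2 := by
      simp only [jumpSample]
      split_ifs <;> simp
    rw [Finset.sum_range_succ, Finset.sum_range_succ, add_assoc, key, hsq, mul_sub, Complex.sub_re]
    rw [hsq (a n)] at ih
    linarith

/-! ### Filtrations by countable partitions into cells -/

/-- A refining sequence of countable measurable partitions: `c n x` is the cell of the `n`-th
partition that contains `x`. The cells have finite measure, and passing to the next partition
decreases the measure of the cell of a point at most by the factor `R`. Cells of measure zero are
allowed. -/
structure IsCellFiltration {X : Type*} [MeasurableSpace X] (μ : Measure X) (c : ℕ → X → Set X)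
    (R : ℝ) : Prop where
  mem_self : ∀ n x, x ∈ c n x
  eq_of_mem : ∀ n x y, y ∈ c n x → c n y = c n x
  succ_subset : ∀ n x, c (n + 1) x ⊆ c n x
  measurableSet : ∀ n x, MeasurableSet (c n x)
  countable_range : ∀ n, (Set.range (c n)).Countable
  measure_lt_top : ∀ n x, μ (c n x) < ∞
  one_le : 1 ≤ R
  measure_le : ∀ n x, μ (c n x) ≤ ENNReal.ofReal R * μ (c (n + 1) x)

/-- The average of `f` over the cell of the `n`-th partition that contains `x`. -/
noncomputable def cellAvg {X : Type*} [MeasurableSpace X] (μ : Measure X) (c : ℕ → X → Set X)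
    (f : X → ℂ) (n : ℕ) (x : X) : ℂ :=
  ⨍ y in c n x, f y ∂μ

/-- `G` is a martingale for the filtration given by the cells: `G n` is constant on the cells of the
`n`-th partition and has the same integrals over these cells as `G (n + 1)`. -/
structure IsCellMartingale {X : Type*} [MeasurableSpace X] (μ : Measure X) (c : ℕ → X → Set X)
    (G : ℕ → X → ℂ) : Prop where
  eq_of_mem : ∀ n x y, y ∈ c n x → G n y = G n x
  integrable : ∀ n, Integrable (G n) μ
  setIntegral_eq : ∀ n x, ∫ y in c n x, G (n + 1) y ∂μ = ∫ y in c n x, G n y ∂μ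

namespace IsCellFiltration

variable {X : Type*} [MeasurableSpace X] {μ : Measure X} {c : ℕ → X → Set X} {R : ℝ}

theorem subset_of_le (hc : IsCellFiltration μ c R) {m n : ℕ} (h : m ≤ n) (x : X) :
    c n x ⊆ c m x :=
  antitone_nat_of_succ_le (f := fun n => c n x) (fun n => hc.succ_subset n x) h

theorem cell_eq (hc : IsCellFiltration μ c R) {m n : ℕ} (h : m ≤ n) {x y : X} (hy : y ∈ c n x) :
    c m y = c m x :=
  hc.eq_of_mem m x y (hc.subset_of_le h x hy)

theorem disjoint_of_ne (hc : IsCellFiltration μ c R) {n : ℕ} {x y : X} (h : c n x ≠ c n y) :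
    Disjoint (c n x) (c n y) := by
  rw [Set.disjoint_left]
  intro z hx hy
  exact h ((hc.eq_of_mem n x z hx).symm.trans (hc.eq_of_mem n y z hy))

theorem measurable_of_const (hc : IsCellFiltration μ c R) {β : Type*} [MeasurableSpace β] {n : ℕ}
    {F : X → β} (hF : ∀ x y, y ∈ c n x → F y = F x) : Measurable F := by
  intro S _
  have : F ⁻¹' S = ⋃₀ {s | s ∈ Set.range (c n) ∧ s ⊆ F ⁻¹' S} := by
    ext x
    simp only [Set.mem_preimage, Set.mem_sUnion, Set.mem_ofPred_eq]
    constructor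
    · intro hx
      refine ⟨c n x, ⟨⟨x, rfl⟩, fun y hy => ?_⟩, hc.mem_self n x⟩
      rw [Set.mem_preimage, hF x y hy]
      exact hx
    · rintro ⟨s, ⟨_, hs⟩, hx⟩
      exact hs hx
  rw [this]
  refine MeasurableSet.sUnion ((hc.countable_range n).mono fun s hs => hs.1) ?_
  rintro s ⟨⟨x, rfl⟩, _⟩
  exact hc.measurableSet n x

theorem measurableSet_of_mem_iff (hc : IsCellFiltration μ c R) {n : ℕ} {S : Set X}
    (hS : ∀ x y, y ∈ c n x → (y ∈ S ↔ x ∈ S)) : MeasurableSet S :=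
  measurableSet_setOfPred.mpr (hc.measurable_of_const (F := fun x => x ∈ S)
    fun x y hy => propext (hS x y hy))

theorem iUnion_range (hc : IsCellFiltration μ c R) (n : ℕ) :
    (⋃ s : Set.range (c n), (s : Set X)) = Set.univ :=
  Set.eq_univ_of_forall fun x => Set.mem_iUnion.mpr ⟨⟨c n x, x, rfl⟩, hc.mem_self n x⟩

theorem pairwise_disjoint_range (hc : IsCellFiltration μ c R) (n : ℕ) :
    Pairwise (Function.onFun Disjoint fun s : Set.range (c n) => (s : Set X)) := by
  rintro ⟨_, x, rfl⟩ ⟨_, y, rfl⟩ h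
  exact hc.disjoint_of_ne fun h' => h (Subtype.ext h')

theorem lintegral_le_of_cells (hc : IsCellFiltration μ c R) (n : ℕ) {φ ψ : X → ℝ≥0∞}
    (h : ∀ x, ∫⁻ y in c n x, φ y ∂μ ≤ ∫⁻ y in c n x, ψ y ∂μ) : ∫⁻ y, φ y ∂μ ≤ ∫⁻ y, ψ y ∂μ := by
  have := (hc.countable_range n).to_subtype
  have hm : ∀ s : Set.range (c n), MeasurableSet (s : Set X) := by
    rintro ⟨_, x, rfl⟩
    exact hc.measurableSet n x
  rw [← setLIntegral_univ φ, ← setLIntegral_univ ψ, ← hc.iUnion_range n,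
    lintegral_iUnion hm (hc.pairwise_disjoint_range n),
    lintegral_iUnion hm (hc.pairwise_disjoint_range n)]
  refine ENNReal.tsum_le_tsum ?_
  rintro ⟨_, x, rfl⟩
  exact h x

theorem integral_eq_zero_of_cells (hc : IsCellFiltration μ c R) (n : ℕ) {φ : X → ℂ}
    (hφ : Integrable φ μ) (h : ∀ x, ∫ y in c n x, φ y ∂μ = 0) : ∫ y, φ y ∂μ = 0 := by
  have := (hc.countable_range n).to_subtype
  have hm : ∀ s : Set.range (c n), MeasurableSet (s : Set X) := by
    rintro ⟨_, x, rfl⟩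
    exact hc.measurableSet n x
  rw [← setIntegral_univ, ← hc.iUnion_range n,
    integral_iUnion hm (hc.pairwise_disjoint_range n) hφ.integrableOn]
  have : ∀ s : Set.range (c n), ∫ y in (s : Set X), φ y ∂μ = 0 := by
    rintro ⟨_, x, rfl⟩
    exact h x
  simp [this]

theorem setLIntegral_le_of_cells (hc : IsCellFiltration μ c R) {n : ℕ} {S : Set X}
    (hS : ∀ x y, y ∈ c n x → (y ∈ S ↔ x ∈ S)) {φ ψ : X → ℝ≥0∞}
    (h : ∀ x ∈ S, ∫⁻ y in c n x, φ y ∂μ ≤ ∫⁻ y in c n x, ψ y ∂μ) :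
    ∫⁻ y in S, φ y ∂μ ≤ ∫⁻ y in S, ψ y ∂μ := by
  have hSm := hc.measurableSet_of_mem_iff hS
  rw [← lintegral_indicator hSm, ← lintegral_indicator hSm]
  refine hc.lintegral_le_of_cells n fun x => ?_
  rw [lintegral_indicator hSm, lintegral_indicator hSm, Measure.restrict_restrict hSm]
  by_cases hx : x ∈ S
  · have : S ∩ c n x = c n x := Set.inter_eq_right.mpr fun y hy => (hS x y hy).mpr hx
    rw [this]
    exact h x hx
  · have : S ∩ c n x = ∅ := by
      rw [← Set.disjoint_iff_inter_eq_empty, Set.disjoint_left]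
      exact fun y hyS hy => hx ((hS x y hy).mp hyS)
    simp [this]

/-- If the events `S n` increase and `S n` is decided at time `n`, then it suffices to compare
integrals over the cells at which a point enters some `S n` for the first time. -/
theorem setLIntegral_le_of_stopping (hc : IsCellFiltration μ c R) {S : ℕ → Set X}
    (hS : ∀ n x y, y ∈ c n x → (y ∈ S n ↔ x ∈ S n)) (hmono : ∀ n, S n ⊆ S (n + 1))
    {φ ψ : X → ℝ≥0∞}
    (h0 : ∀ x ∈ S 0, ∫⁻ y in c 0 x, φ y ∂μ ≤ ∫⁻ y in c 0 x, ψ y ∂μ)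
    (h : ∀ n, ∀ x ∈ S (n + 1), x ∉ S n →
      ∫⁻ y in c (n + 1) x, φ y ∂μ ≤ ∫⁻ y in c (n + 1) x, ψ y ∂μ) (L : ℕ) :
    ∫⁻ y in S L, φ y ∂μ ≤ ∫⁻ y in S L, ψ y ∂μ := by
  induction L with
  | zero => exact hc.setLIntegral_le_of_cells (hS 0) h0
  | succ n ih =>
    have hnew : ∀ x y, y ∈ c (n + 1) x → (y ∈ S (n + 1) \ S n ↔ x ∈ S (n + 1) \ S n) := by
      intro x y hy
      rw [Set.mem_sdiff, Set.mem_sdiff, hS (n + 1) x y hy, hS n x y (hc.succ_subset n x hy)]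
    have hm := hc.measurableSet_of_mem_iff hnew
    have hdisj : Disjoint (S n) (S (n + 1) \ S n) := Set.disjoint_sdiff_right
    rw [← Set.union_sdiff_cancel (hmono n), lintegral_union hm hdisj, lintegral_union hm hdisj]
    exact add_le_add ih (hc.setLIntegral_le_of_cells hnew fun x hx => h n x hx.1 hx.2)

/-! ### Averages over cells -/

theorem cellAvg_eq_of_mem (hc : IsCellFiltration μ c R) (f : X → ℂ) {m n : ℕ} (h : m ≤ n) {x y : X}
    (hy : y ∈ c n x) : cellAvg μ c f m y = cellAvg μ c f m x := by
  rw [cellAvg, cellAvg, hc.cell_eq h hy]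

theorem measurable_cellAvg (hc : IsCellFiltration μ c R) (f : X → ℂ) (n : ℕ) :
    Measurable (cellAvg μ c f n) :=
  hc.measurable_of_const fun _ _ hy => hc.cellAvg_eq_of_mem f le_rfl hy

theorem setIntegral_cellAvg (hc : IsCellFiltration μ c R) (f : X → ℂ) (n : ℕ) (x : X) :
    ∫ y in c n x, cellAvg μ c f n y ∂μ = ∫ y in c n x, f y ∂μ := by
  rw [setIntegral_congr_fun (hc.measurableSet n x)
    (g := fun _ => cellAvg μ c f n x) fun y hy => hc.cellAvg_eq_of_mem f le_rfl hy,
    setIntegral_const]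
  exact measure_smul_setAverage f (hc.measure_lt_top n x).ne

theorem enorm_cellAvg_mul_le (hc : IsCellFiltration μ c R) (f : X → ℂ) (n : ℕ) (x : X) :
    ‖cellAvg μ c f n x‖ₑ * μ (c n x) ≤ ∫⁻ y in c n x, ‖f y‖ₑ ∂μ := by
  have h := measure_smul_setAverage f (hc.measure_lt_top n x).ne
  calc ‖cellAvg μ c f n x‖ₑ * μ (c n x) = ‖∫ y in c n x, f y ∂μ‖ₑ := by
        rw [← h, enorm_smul, mul_comm, Real.enorm_of_nonneg measureReal_nonneg,
          ofReal_measureReal (hc.measure_lt_top n x).ne]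
        rfl
    _ ≤ _ := enorm_integral_le_lintegral_enorm _

theorem enorm_cellAvg_le (hc : IsCellFiltration μ c R) {f : X → ℂ} {n : ℕ} {x : X} {K : ℝ≥0∞}
    (h : ∫⁻ y in c n x, ‖f y‖ₑ ∂μ ≤ K * μ (c n x)) : ‖cellAvg μ c f n x‖ₑ ≤ K := by
  by_cases h0 : μ (c n x) = 0
  · have : cellAvg μ c f n x = 0 := by
      rw [cellAvg, Measure.restrict_eq_zero.mpr h0, average_zero_measure]
    simp [this]
  · have h1 := (hc.enorm_cellAvg_mul_le f n x).trans h
    exact (ENNReal.mul_le_mul_iff_left h0 (hc.measure_lt_top n x).ne).mp h1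

theorem setLIntegral_enorm_cellAvg_le (hc : IsCellFiltration μ c R) (f : X → ℂ) (n : ℕ) (x : X) :
    ∫⁻ y in c n x, ‖cellAvg μ c f n y‖ₑ ∂μ ≤ ∫⁻ y in c n x, ‖f y‖ₑ ∂μ := by
  rw [setLIntegral_congr_fun (hc.measurableSet n x)
    (g := fun _ => ‖cellAvg μ c f n x‖ₑ)
    fun y hy => by simp only [hc.cellAvg_eq_of_mem f le_rfl hy],
    setLIntegral_const]
  exact hc.enorm_cellAvg_mul_le f n x

theorem integrable_cellAvg (hc : IsCellFiltration μ c R) {f : X → ℂ} (hf : Integrable f μ) (n : ℕ) :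
    Integrable (cellAvg μ c f n) μ :=
  ⟨(hc.measurable_cellAvg f n).aestronglyMeasurable,
    (hc.lintegral_le_of_cells n (hc.setLIntegral_enorm_cellAvg_le f n)).trans_lt
      hf.hasFiniteIntegral⟩

theorem isCellMartingale_cellAvg (hc : IsCellFiltration μ c R) {f : X → ℂ} (hf : Integrable f μ) :
    IsCellMartingale μ c (cellAvg μ c f) := by
  refine ⟨fun n x y hy => hc.cellAvg_eq_of_mem f le_rfl hy, hc.integrable_cellAvg hf,
    fun n x => ?_⟩
  rw [hc.setIntegral_cellAvg f n x, ← sub_eq_zero, ← integral_sub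
    (hc.integrable_cellAvg hf _).integrableOn hf.integrableOn, ← integral_indicator
    (hc.measurableSet n x)]
  refine hc.integral_eq_zero_of_cells (n + 1) ((((hc.integrable_cellAvg hf _).sub hf).indicator
    (hc.measurableSet n x))) fun z => ?_
  rw [integral_indicator (hc.measurableSet n x), Measure.restrict_restrict (hc.measurableSet n x)]
  by_cases hz : z ∈ c n x
  · have : c n x ∩ c (n + 1) z = c (n + 1) z :=
      Set.inter_eq_right.mpr ((hc.succ_subset n z).trans (hc.eq_of_mem n x z hz).subset)
    rw [this, integral_sub (hc.integrable_cellAvg hf _).integrableOn hf.integrableOn,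
      hc.setIntegral_cellAvg, sub_self]
  · have : c n x ∩ c (n + 1) z = ∅ := by
      rw [← Set.disjoint_iff_inter_eq_empty, Set.disjoint_left]
      intro y hyx hyz
      refine hz ?_
      rw [← hc.eq_of_mem n x y hyx, hc.eq_of_mem n z y (hc.succ_subset n z hyz)]
      exact hc.mem_self n z
    simp [this]

/-! ### Square functions of sampled martingales -/

/-- The square function of a bounded martingale sampled at its jumps is bounded on `L²`: by
`sum_sq_jumpSample_eq` it differs from `|G n|²` by terms that are at most zero and by martingale
differences multiplied by functions known beforehand, whose integrals vanish. -/
theorem lintegral_sum_sq_jumpSample_le (hc : IsCellFiltration μ c R) {G : ℕ → X → ℂ}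
    (hG : IsCellMartingale μ c G) {B : ℝ} (hB : ∀ n x, ‖G n x‖ ≤ B) {t : ℝ} {K : ℝ≥0∞}
    (hK : ∀ n, ∫⁻ x, ‖G n x‖ₑ ^ 2 ∂μ ≤ K) :
    ∫⁻ x, ∑' n, ‖jumpSample t (fun k => G k x) (n + 1) - jumpSample t (fun k => G k x) n‖ₑ ^ 2 ∂μ
      ≤ K := by
  have hconst : ∀ n x y, y ∈ c n x →
      jumpSample t (fun k => G k y) n = jumpSample t (fun k => G k x) n := by
    intro n
    induction n with
    | zero => exact fun x y hy => hG.eq_of_mem 0 x y hy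
    | succ n ih =>
      intro x y hy
      simp only [jumpSample, hG.eq_of_mem (n + 1) x y hy, ih x y (hc.succ_subset n x hy)]
  have hmeas : ∀ n, Measurable fun x => jumpSample t (fun k => G k x) n :=
    fun n => hc.measurable_of_const (hconst n)
  have hint : ∀ n, Integrable (fun x => starRingEnd ℂ (jumpSample t (fun k => G k x) n) *
      (G (n + 1) x - G n x)) μ := by
    intro n
    refine ((hG.integrable _).sub (hG.integrable _)).bdd_mul (c := B)
      (Complex.continuous_conj.measurable.comp (hmeas n)).aestronglyMeasurable
      (Filter.Eventually.of_forall fun x => ?_)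
    rw [RCLike.norm_conj]
    exact norm_jumpSample_le (fun k => hB k x) n
  have hzero : ∀ n, ∫ x, (starRingEnd ℂ (jumpSample t (fun k => G k x) n) *
      (G (n + 1) x - G n x)).re ∂μ = 0 := by
    intro n
    have h0 : ∫ x, starRingEnd ℂ (jumpSample t (fun k => G k x) n) *
        (G (n + 1) x - G n x) ∂μ = 0 := by
      refine hc.integral_eq_zero_of_cells n (hint n) fun x => ?_
      rw [setIntegral_congr_fun (hc.measurableSet n x)
        (g := fun y => starRingEnd ℂ (jumpSample t (fun k => G k x) n) * (G (n + 1) y - G n y))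
        fun y hy => by simp only [hconst n x y hy], integral_const_mul,
        integral_sub (hG.integrable _).integrableOn (hG.integrable _).integrableOn,
        hG.setIntegral_eq, sub_self, mul_zero]
    have := integral_re (hint n)
    simp only [RCLike.re_eq_complex_re] at this
    rw [this, h0, Complex.zero_re]
  have hsq : ∀ n, Integrable (fun x => ‖G n x‖ ^ 2) μ := by
    intro n
    simp_rw [pow_two]
    exact (hG.integrable n).norm.bdd_mul (c := B) (hG.integrable n).norm.aestronglyMeasurable
      (Filter.Eventually.of_forall fun x => by simpa using hB n x)
  rw [lintegral_tsum fun n => by fun_prop]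
  refine ENNReal.tsum_le_of_sum_range_le fun n => ?_
  rw [← lintegral_finsetSum _ fun i _ => by fun_prop]
  have hre : ∀ i, Integrable (fun x =>
      (starRingEnd ℂ (jumpSample t (fun k => G k x) i) * (G (i + 1) x - G i x)).re) μ :=
    fun i => (hint i).re
  have hψ : Integrable (fun x => ‖G n x‖ ^ 2 - 2 * ∑ i ∈ Finset.range n,
      (starRingEnd ℂ (jumpSample t (fun k => G k x) i) * (G (i + 1) x - G i x)).re) μ :=
    (hsq n).sub ((integrable_finsetSum _ fun i _ => hre i).const_mul 2)
  have hle : ∀ x, ∑ i ∈ Finset.range n, ‖jumpSample t (fun k => G k x) (i + 1) -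
        jumpSample t (fun k => G k x) i‖ ^ 2 ≤ ‖G n x‖ ^ 2 - 2 * ∑ i ∈ Finset.range n,
      (starRingEnd ℂ (jumpSample t (fun k => G k x) i) * (G (i + 1) x - G i x)).re := by
    intro x
    have := sum_sq_jumpSample_eq t (fun k => G k x) n
    nlinarith [sq_nonneg ‖G 0 x‖, sq_nonneg ‖G n x - jumpSample t (fun k => G k x) n‖]
  have hsum0 : ∀ x, 0 ≤ ∑ i ∈ Finset.range n, ‖jumpSample t (fun k => G k x) (i + 1) -
        jumpSample t (fun k => G k x) i‖ ^ 2 := fun x => Finset.sum_nonneg fun i _ => by positivity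
  have henorm : ∀ z : ℂ, ‖z‖ₑ ^ 2 = ENNReal.ofReal (‖z‖ ^ 2) := fun z => by
    rw [ENNReal.ofReal_pow (norm_nonneg _), ofReal_norm]
  calc ∫⁻ x, ∑ i ∈ Finset.range n, ‖jumpSample t (fun k => G k x) (i + 1) -
        jumpSample t (fun k => G k x) i‖ₑ ^ 2 ∂μ
      ≤ ∫⁻ x, ENNReal.ofReal (‖G n x‖ ^ 2 - 2 * ∑ i ∈ Finset.range n,
      (starRingEnd ℂ (jumpSample t (fun k => G k x) i) * (G (i + 1) x - G i x)).re) ∂μ := by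
        refine lintegral_mono fun x => ?_
        simp_rw [henorm]
        rw [← ENNReal.ofReal_sum_of_nonneg fun i _ => by positivity]
        exact ENNReal.ofReal_le_ofReal (hle x)
    _ = ENNReal.ofReal (∫ x, ‖G n x‖ ^ 2 ∂μ) := by
        rw [← ofReal_integral_eq_lintegral_ofReal hψ
          (Filter.Eventually.of_forall fun x => (hsum0 x).trans (hle x)),
          integral_sub (hsq n) ((integrable_finsetSum _ fun i _ => hre i).const_mul 2),
          integral_const_mul, integral_finsetSum _ fun i _ => hre i]
        rw [Finset.sum_eq_zero fun i _ => hzero i, mul_zero, sub_zero]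
    _ = ∫⁻ x, ‖G n x‖ₑ ^ 2 ∂μ := by
        rw [ofReal_integral_eq_lintegral_ofReal (hsq n)
          (Filter.Eventually.of_forall fun x => by positivity)]
        simp_rw [henorm]
    _ ≤ K := hK n

end IsCellFiltration

/-! ### Stopping when the averages become large -/

/-- Up to time `n`, the averages of `‖f‖` over the cells containing `x` are at most `t`. -/
def AvgLeUpTo {X : Type*} [MeasurableSpace X] (μ : Measure X) (c : ℕ → X → Set X) (f : X → ℂ)
    (t : ℝ≥0∞) (n : ℕ) (x : X) : Prop :=
  ∀ m ≤ n, ∫⁻ y in c m x, ‖f y‖ₑ ∂μ ≤ t * μ (c m x)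

open Classical in
/-- The martingale of cell averages of `f`, stopped at the first time at which the average of `‖f‖`
exceeds `t`, and set to zero where this happens at time `0`. -/
noncomputable def stoppedAvg {X : Type*} [MeasurableSpace X] (μ : Measure X) (c : ℕ → X → Set X)
    (f : X → ℂ) (t : ℝ≥0∞) : ℕ → X → ℂ
  | 0, x => if AvgLeUpTo μ c f t 0 x then cellAvg μ c f 0 x else 0
  | n + 1, x => stoppedAvg μ c f t n x +
      if AvgLeUpTo μ c f t n x then cellAvg μ c f (n + 1) x - cellAvg μ c f n x else 0

namespace IsCellFiltration

variable {X : Type*} [MeasurableSpace X] {μ : Measure X} {c : ℕ → X → Set X} {R : ℝ}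

theorem avgLeUpTo_iff (hc : IsCellFiltration μ c R) (f : X → ℂ) (t : ℝ≥0∞) {n : ℕ} {x y : X}
    (hy : y ∈ c n x) : AvgLeUpTo μ c f t n y ↔ AvgLeUpTo μ c f t n x :=
  forall₂_congr fun m hm => by rw [hc.cell_eq hm hy]

/-- To compare integrals over the set on which some average of `‖f‖` exceeds `t`, it suffices to
compare them over the cells over which the average exceeds `t`. -/
theorem setLIntegral_not_avgLeUpTo_le (hc : IsCellFiltration μ c R) {f : X → ℂ} {t : ℝ≥0∞}
    {φ ψ : X → ℝ≥0∞}
    (h : ∀ n x, t * μ (c n x) < ∫⁻ y in c n x, ‖f y‖ₑ ∂μ →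
      ∫⁻ y in c n x, φ y ∂μ ≤ ∫⁻ y in c n x, ψ y ∂μ) (L : ℕ) :
    ∫⁻ y in {x | ¬ AvgLeUpTo μ c f t L x}, φ y ∂μ ≤
      ∫⁻ y in {x | ¬ AvgLeUpTo μ c f t L x}, ψ y ∂μ := by
  refine hc.setLIntegral_le_of_stopping (S := fun L => {x | ¬ AvgLeUpTo μ c f t L x})
    (fun n x y hy => not_congr (hc.avgLeUpTo_iff f t hy))
    (fun n x hx hx' => hx fun m hm => hx' m (hm.trans n.le_succ)) ?_ ?_ L
  · intro x hx
    refine h 0 x (lt_of_not_ge fun h0 => hx fun m hm => ?_)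
    obtain rfl : m = 0 := by omega
    exact h0
  · intro n x hx hx'
    refine h (n + 1) x (lt_of_not_ge fun h0 => hx fun m hm => ?_)
    rcases Nat.lt_or_ge n m with h1 | h1
    · obtain rfl : m = n + 1 := by omega
      exact h0
    · exact (not_not.mp hx') m h1

theorem mul_measure_not_avgLeUpTo_le (hc : IsCellFiltration μ c R) (f : X → ℂ) (t : ℝ≥0∞) (L : ℕ) :
    t * μ {x | ¬ AvgLeUpTo μ c f t L x} ≤ ∫⁻ x, ‖f x‖ₑ ∂μ := by
  rw [← setLIntegral_const]
  refine (hc.setLIntegral_not_avgLeUpTo_le (f := f) (fun n x h => ?_) L).trans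
    (setLIntegral_le_lintegral _ _)
  rw [setLIntegral_const]
  exact h.le

open Classical in
theorem stoppedAvg_eq_of_mem (hc : IsCellFiltration μ c R) (f : X → ℂ) (t : ℝ≥0∞) (n : ℕ) :
    ∀ x y, y ∈ c n x → stoppedAvg μ c f t n y = stoppedAvg μ c f t n x := by
  induction n with
  | zero =>
    intro x y hy
    simp only [stoppedAvg, hc.cellAvg_eq_of_mem f le_rfl hy]
    exact if_congr (hc.avgLeUpTo_iff f t hy) rfl rfl
  | succ n ih =>
    intro x y hy
    have hy' := hc.succ_subset n x hy
    simp only [stoppedAvg, hc.cellAvg_eq_of_mem f le_rfl hy,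
      hc.cellAvg_eq_of_mem f le_rfl hy', ih x y hy']
    rw [if_congr (hc.avgLeUpTo_iff f t hy') rfl rfl]

theorem stoppedAvg_eq_cellAvg {f : X → ℂ} {t : ℝ≥0∞} {n : ℕ}
    {x : X} (h : AvgLeUpTo μ c f t n x) : stoppedAvg μ c f t n x = cellAvg μ c f n x := by
  induction n with
  | zero => rw [stoppedAvg, if_pos h]
  | succ n ih =>
    have h' : AvgLeUpTo μ c f t n x := fun m hm => h m (hm.trans n.le_succ)
    rw [stoppedAvg, if_pos h', ih h']
    ring

theorem stoppedAvg_succ_of_avgLeUpTo {f : X → ℂ} {t : ℝ≥0∞} {n : ℕ}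
    {x : X} (h : AvgLeUpTo μ c f t n x) :
    stoppedAvg μ c f t (n + 1) x = cellAvg μ c f (n + 1) x := by
  rw [stoppedAvg, if_pos h, stoppedAvg_eq_cellAvg h]
  ring

theorem stoppedAvg_succ_of_not {f : X → ℂ} {t : ℝ≥0∞} {n : ℕ}
    {x : X} (h : ¬ AvgLeUpTo μ c f t n x) :
    stoppedAvg μ c f t (n + 1) x = stoppedAvg μ c f t n x := by
  rw [stoppedAvg, if_neg h, add_zero]

/-- The stopped martingale overshoots the level `t` by at most the factor `R`. -/
theorem enorm_stoppedAvg_le (hc : IsCellFiltration μ c R) (f : X → ℂ) (t : ℝ≥0∞) (n : ℕ) (x : X) :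
    ‖stoppedAvg μ c f t n x‖ₑ ≤ ENNReal.ofReal R * t := by
  induction n with
  | zero =>
    rw [stoppedAvg]
    split_ifs with h
    · refine (hc.enorm_cellAvg_le (h 0 le_rfl)).trans ?_
      exact le_mul_of_one_le_left zero_le (by simpa using hc.one_le)
    · simp
  | succ n ih =>
    by_cases h : AvgLeUpTo μ c f t n x
    · rw [stoppedAvg_succ_of_avgLeUpTo h]
      refine hc.enorm_cellAvg_le ?_
      calc ∫⁻ y in c (n + 1) x, ‖f y‖ₑ ∂μ ≤ ∫⁻ y in c n x, ‖f y‖ₑ ∂μ :=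
            lintegral_mono_set (hc.succ_subset n x)
        _ ≤ t * μ (c n x) := h n le_rfl
        _ ≤ t * (ENNReal.ofReal R * μ (c (n + 1) x)) := by gcongr; exact hc.measure_le n x
        _ = _ := by ring
    · rwa [stoppedAvg_succ_of_not h]

open Classical in
theorem isCellMartingale_stoppedAvg (hc : IsCellFiltration μ c R) {f : X → ℂ}
    (hf : Integrable f μ) (t : ℝ≥0∞) : IsCellMartingale μ c (stoppedAvg μ c f t) := by
  have hM := hc.isCellMartingale_cellAvg hf
  have hSm : ∀ n, MeasurableSet {x | AvgLeUpTo μ c f t n x} := fun n =>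
    hc.measurableSet_of_mem_iff (n := n) fun x y hy => hc.avgLeUpTo_iff f t hy
  have hind : ∀ n (g : X → ℂ), (fun x => if AvgLeUpTo μ c f t n x then g x else 0) =
      {x | AvgLeUpTo μ c f t n x}.indicator g := by
    intro n g
    funext x
    simp [Set.indicator_apply]
  have hint : ∀ n, Integrable (stoppedAvg μ c f t n) μ := by
    intro n
    induction n with
    | zero =>
      have : stoppedAvg μ c f t 0 = {x | AvgLeUpTo μ c f t 0 x}.indicator (cellAvg μ c f 0) := by
        rw [← hind]
        rfl
      rw [this]
      exact (hM.integrable 0).indicator (hSm 0)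
    | succ n ih =>
      have : stoppedAvg μ c f t (n + 1) = stoppedAvg μ c f t n +
          {x | AvgLeUpTo μ c f t n x}.indicator
            (fun x => cellAvg μ c f (n + 1) x - cellAvg μ c f n x) := by
        rw [← hind]
        rfl
      rw [this]
      exact ih.add (((hM.integrable _).sub (hM.integrable _)).indicator (hSm n))
  refine ⟨fun n => hc.stoppedAvg_eq_of_mem f t n, hint, fun n x => ?_⟩
  by_cases h : AvgLeUpTo μ c f t n x
  · rw [setIntegral_congr_fun (hc.measurableSet n x) (g := cellAvg μ c f (n + 1)) fun y hy =>
        stoppedAvg_succ_of_avgLeUpTo ((hc.avgLeUpTo_iff f t hy).mpr h),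
      setIntegral_congr_fun (hc.measurableSet n x) (g := cellAvg μ c f n) fun y hy =>
        stoppedAvg_eq_cellAvg ((hc.avgLeUpTo_iff f t hy).mpr h)]
    exact hM.setIntegral_eq n x
  · exact setIntegral_congr_fun (hc.measurableSet n x) fun y hy =>
      stoppedAvg_succ_of_not fun h' => h ((hc.avgLeUpTo_iff f t hy).mp h')

open Classical in
/-- Stopping does not increase the `L¹` norm. The proof replaces `f`, one time step after the other,
by its stopped averages on the cells on which the stopping occurs. -/
theorem lintegral_enorm_stoppedAvg_le (hc : IsCellFiltration μ c R) (f : X → ℂ) (t : ℝ≥0∞)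
    (n : ℕ) : ∫⁻ x, ‖stoppedAvg μ c f t n x‖ₑ ∂μ ≤ ∫⁻ x, ‖f x‖ₑ ∂μ := by
  have hstep : ∀ n, ∫⁻ x, (if AvgLeUpTo μ c f t n x then ‖f x‖ₑ else ‖stoppedAvg μ c f t n x‖ₑ) ∂μ
      ≤ ∫⁻ x, ‖f x‖ₑ ∂μ := by
    intro n
    induction n with
    | zero =>
      refine lintegral_mono fun x => ?_
      simp only [stoppedAvg]
      split_ifs <;> simp
    | succ n ih =>
      refine le_trans (hc.lintegral_le_of_cells (n + 1) fun x => ?_) ih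
      by_cases h : AvgLeUpTo μ c f t n x
      · have hy : ∀ y ∈ c (n + 1) x, AvgLeUpTo μ c f t n y := fun y hy =>
          (hc.avgLeUpTo_iff f t (hc.succ_subset n x hy)).mpr h
        rw [setLIntegral_congr_fun (hc.measurableSet (n + 1) x) (f := fun y =>
          if AvgLeUpTo μ c f t n y then ‖f y‖ₑ else ‖stoppedAvg μ c f t n y‖ₑ)
          (g := fun y => ‖f y‖ₑ) fun y h' => if_pos (hy y h')]
        by_cases h1 : AvgLeUpTo μ c f t (n + 1) x
        · exact (setLIntegral_congr_fun (hc.measurableSet (n + 1) x) fun y h' =>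
            if_pos ((hc.avgLeUpTo_iff f t h').mpr h1)).le
        · refine le_trans (le_of_eq ?_) (hc.setLIntegral_enorm_cellAvg_le f (n + 1) x)
          refine setLIntegral_congr_fun (hc.measurableSet (n + 1) x) fun y h' => ?_
          rw [if_neg fun h2 => h1 ((hc.avgLeUpTo_iff f t h').mp h2),
            stoppedAvg_succ_of_avgLeUpTo (hy y h')]
      · refine (setLIntegral_congr_fun (hc.measurableSet (n + 1) x) fun y h' => ?_).le
        have h1 : ¬ AvgLeUpTo μ c f t n y := fun h2 =>
          h ((hc.avgLeUpTo_iff f t (hc.succ_subset n x h')).mp h2)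
        have h2 : ¬ AvgLeUpTo μ c f t (n + 1) y := fun h2 =>
          h1 fun m hm => h2 m (hm.trans n.le_succ)
        rw [if_neg h1, if_neg h2, stoppedAvg_succ_of_not h1]
  refine le_trans (hc.lintegral_le_of_cells n fun x => ?_) (hstep n)
  by_cases h : AvgLeUpTo μ c f t n x
  · rw [setLIntegral_congr_fun (hc.measurableSet n x) (f := fun y =>
        if AvgLeUpTo μ c f t n y then ‖f y‖ₑ else ‖stoppedAvg μ c f t n y‖ₑ)
        (g := fun y => ‖f y‖ₑ) fun y h' => if_pos ((hc.avgLeUpTo_iff f t h').mpr h)]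
    refine le_trans (le_of_eq ?_) (hc.setLIntegral_enorm_cellAvg_le f n x)
    refine setLIntegral_congr_fun (hc.measurableSet n x) fun y h' => ?_
    rw [stoppedAvg_eq_cellAvg ((hc.avgLeUpTo_iff f t h').mpr h)]
  · refine (setLIntegral_congr_fun (hc.measurableSet n x) fun y h' => ?_).le
    rw [if_neg fun h2 => h ((hc.avgLeUpTo_iff f t h').mp h2)]

/-! ### The weak type `(1, 1)` inequality -/

theorem lintegral_sq_stoppedAvg_le (hc : IsCellFiltration μ c R) (f : X → ℂ) (t : ℝ≥0∞) (n : ℕ) :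
    ∫⁻ x, ‖stoppedAvg μ c f t n x‖ₑ ^ 2 ∂μ ≤ ENNReal.ofReal R * t * ∫⁻ x, ‖f x‖ₑ ∂μ := by
  calc ∫⁻ x, ‖stoppedAvg μ c f t n x‖ₑ ^ 2 ∂μ
      ≤ ∫⁻ x, ENNReal.ofReal R * t * ‖stoppedAvg μ c f t n x‖ₑ ∂μ := by
        refine lintegral_mono fun x => ?_
        rw [pow_two]
        gcongr
        exact hc.enorm_stoppedAvg_le f t n x
    _ = ENNReal.ofReal R * t * ∫⁻ x, ‖stoppedAvg μ c f t n x‖ₑ ∂μ := by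
        refine lintegral_const_mul _ ?_
        exact (hc.measurable_of_const (hc.stoppedAvg_eq_of_mem f t n)).enorm
    _ ≤ _ := mul_le_mul' le_rfl (hc.lintegral_enorm_stoppedAvg_le f t n)

theorem tsum_ofReal_geometric_rpow {r s : ℝ} (hr : 2 < r) (hs : 0 < s) :
    ∑' m : ℕ, ENNReal.ofReal ((s * (1 / 2) ^ m) ^ (r - 2)) =
      ENNReal.ofReal (s ^ (r - 2) * (1 - (1 / 2) ^ (r - 2))⁻¹) := by
  have h0 : (0 : ℝ) ≤ (1 / 2) ^ (r - 2) := by positivity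
  have h1 : (1 / 2 : ℝ) ^ (r - 2) < 1 :=
    Real.rpow_lt_one (by norm_num) (by norm_num) (by linarith)
  have hterm : ∀ m : ℕ, (s * (1 / 2) ^ m) ^ (r - 2) = s ^ (r - 2) * ((1 / 2) ^ (r - 2)) ^ m := by
    intro m
    rw [Real.mul_rpow hs.le (by positivity), ← Real.rpow_natCast, ← Real.rpow_natCast,
      ← Real.rpow_mul (by norm_num), ← Real.rpow_mul (by norm_num), mul_comm (m : ℝ)]
  simp_rw [hterm]
  rw [← ENNReal.ofReal_tsum_of_nonneg (fun m => by positivity)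
    ((summable_geometric_of_lt_one h0 h1).mul_left _), tsum_mul_left,
    tsum_geometric_of_lt_one h0 h1]

theorem one_sub_half_rpow_inv_le {r : ℝ} (hr : 2 < r) :
    (1 - (1 / 2 : ℝ) ^ (r - 2))⁻¹ ≤ r / (r - 2) := by
  have hr0 : 0 < r := by linarith
  have hr2 : 0 < r - 2 := by linarith
  have h2 : r / 2 ≤ (2 : ℝ) ^ (r - 2) := by
    rw [Real.rpow_def_of_pos (by norm_num)]
    have := Real.add_one_le_exp (Real.log 2 * (r - 2))
    nlinarith [Real.log_two_gt_d9]
  have h3 : (1 / 2 : ℝ) ^ (r - 2) ≤ 2 / r := by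
    rw [one_div, Real.inv_rpow (by norm_num), ← inv_div r 2]
    exact inv_anti₀ (by positivity) h2
  rw [← inv_div (r - 2) r]
  refine inv_anti₀ (by positivity) ?_
  rw [sub_div, div_self hr0.ne']
  linarith

/-- The variation of the averages of an integrable function is of weak type `(1, 1)`. Where the
averages of `‖f‖` stay below `s / (2 * R)`, the martingale agrees with the stopped one, which is
bounded by `s / 2`; there `seqVar_rpow_le` reduces the claim to the `L²` bounds of the sampled
square functions, with weights that form a geometric series. -/
theorem measure_lt_seqVar_le (hc : IsCellFiltration μ c R) {f : X → ℂ} (hf : Integrable f μ)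
    {r s : ℝ} (hr : 2 < r) (hs : 0 < s) :
    μ {x | ENNReal.ofReal s < seqVar r fun n => cellAvg μ c f n x} ≤
      ENNReal.ofReal ((2 * R + 32) * (r / (r - 2)) / s) * ∫⁻ x, ‖f x‖ₑ ∂μ := by
  have hR : 0 < R := zero_lt_one.trans_le hc.one_le
  have hr0 : 0 < r := by linarith
  have hr2 : 0 < r - 2 := by linarith
  set t : ℝ≥0∞ := ENNReal.ofReal (s / (2 * R)) with ht
  have ht0 : t ≠ 0 := by
    rw [ht, Ne, ENNReal.ofReal_eq_zero, not_le]
    positivity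
  have hRt : ENNReal.ofReal R * t = ENNReal.ofReal (s / 2) := by
    rw [ht, ← ENNReal.ofReal_mul hR.le]
    congr 1
    field_simp
  set G := stoppedAvg μ c f t
  have hG := hc.isCellMartingale_stoppedAvg hf t
  have hGB : ∀ n x, ‖G n x‖ ≤ s / 2 := by
    intro n x
    have := hc.enorm_stoppedAvg_le f t n x
    rwa [hRt, ← ofReal_norm, ENNReal.ofReal_le_ofReal_iff (by positivity)] at this
  have hK : ∀ n, ∫⁻ x, ‖G n x‖ₑ ^ 2 ∂μ ≤ ENNReal.ofReal (s / 2) * ∫⁻ x, ‖f x‖ₑ ∂μ := by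
    intro n
    rw [← hRt]
    exact hc.lintegral_sq_stoppedAvg_le f t n
  have hΩ : μ (⋃ n, {x | ¬ AvgLeUpTo μ c f t n x}) ≤
      ENNReal.ofReal (2 * R / s) * ∫⁻ x, ‖f x‖ₑ ∂μ := by
    have hmono : Monotone fun n => {x | ¬ AvgLeUpTo μ c f t n x} :=
      fun m n hmn x hx hx' => hx fun k hk => hx' k (hk.trans hmn)
    rw [hmono.measure_iUnion]
    refine iSup_le fun n => ?_
    have h := hc.mul_measure_not_avgLeUpTo_le f t n
    have hinv : ENNReal.ofReal (2 * R / s) = t⁻¹ := by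
      rw [ht, ← ENNReal.ofReal_inv_of_pos (by positivity), inv_div]
    rw [hinv, mul_comm, ← div_eq_mul_inv]
    rwa [ENNReal.le_div_iff_mul_le (Or.inl ht0) (Or.inl ENNReal.ofReal_ne_top), mul_comm]
  set V : X → ℝ≥0∞ := fun x => 64 *
    ∑' m : ℕ, ENNReal.ofReal ((2 * (s / 2) * (1 / 2) ^ m) ^ (r - 2)) *
      ∑' n, ‖jumpSample (s / 2 * (1 / 2) ^ m / 4) (fun k => G k x) (n + 1) -
        jumpSample (s / 2 * (1 / 2) ^ m / 4) (fun k => G k x) n‖ₑ ^ 2 with hV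
  have hmeasJ : ∀ u n, Measurable fun x => jumpSample u (fun k => G k x) n := by
    intro u n
    induction n with
    | zero => exact hc.measurable_of_const (hG.eq_of_mem 0)
    | succ n ih =>
      have hGm : Measurable (G (n + 1)) := hc.measurable_of_const (hG.eq_of_mem (n + 1))
      simp only [jumpSample]
      exact Measurable.ite (measurableSet_le measurable_const (hGm.sub ih).norm) hGm ih
  have hmeasS : ∀ u, Measurable fun x => ∑' n, ‖jumpSample u (fun k => G k x) (n + 1) -
        jumpSample u (fun k => G k x) n‖ₑ ^ 2 := fun u =>
    Measurable.tsum fun n => ((hmeasJ u (n + 1)).sub (hmeasJ u n)).enorm.pow_const 2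
  have hVm : Measurable V :=
    (Measurable.tsum fun m => (hmeasS _).const_mul _).const_mul _
  have hVint : ∫⁻ x, V x ∂μ ≤ ENNReal.ofReal (s ^ r * (32 * (r / (r - 2)) / s)) *
      ∫⁻ x, ‖f x‖ₑ ∂μ := by
    rw [hV, lintegral_const_mul _ (Measurable.tsum fun m => (hmeasS _).const_mul _),
      lintegral_tsum fun m => ((hmeasS _).const_mul _).aemeasurable]
    calc 64 * ∑' m : ℕ, ∫⁻ x, ENNReal.ofReal ((2 * (s / 2) * (1 / 2) ^ m) ^ (r - 2)) *
          ∑' n, ‖jumpSample (s / 2 * (1 / 2) ^ m / 4) (fun k => G k x) (n + 1) -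
            jumpSample (s / 2 * (1 / 2) ^ m / 4) (fun k => G k x) n‖ₑ ^ 2 ∂μ
        ≤ 64 * ∑' m : ℕ, ENNReal.ofReal ((s * (1 / 2) ^ m) ^ (r - 2)) *
            (ENNReal.ofReal (s / 2) * ∫⁻ x, ‖f x‖ₑ ∂μ) := by
          gcongr with m
          rw [lintegral_const_mul _ (hmeasS _), mul_div_cancel₀ s two_ne_zero]
          gcongr
          exact hc.lintegral_sum_sq_jumpSample_le hG hGB hK
      _ = ENNReal.ofReal (64 * (s ^ (r - 2) * (1 - (1 / 2) ^ (r - 2))⁻¹) * (s / 2)) *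
            ∫⁻ x, ‖f x‖ₑ ∂μ := by
          rw [ENNReal.tsum_mul_right, tsum_ofReal_geometric_rpow hr hs, ← mul_assoc, ← mul_assoc,
            ENNReal.ofReal_mul' (q := s / 2) (by positivity),
            ENNReal.ofReal_mul (p := 64) (by norm_num)]
          norm_num
      _ ≤ _ := by
          refine mul_le_mul' (ENNReal.ofReal_le_ofReal ?_) le_rfl
          have hsr : s ^ r = s ^ (r - 2) * s ^ 2 := by
            rw [← Real.rpow_natCast, ← Real.rpow_add hs]
            norm_num
          rw [hsr]
          have := one_sub_half_rpow_inv_le hr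
          calc 64 * (s ^ (r - 2) * (1 - (1 / 2) ^ (r - 2))⁻¹) * (s / 2)
              ≤ 64 * (s ^ (r - 2) * (r / (r - 2))) * (s / 2) := by gcongr
            _ = _ := by
              generalize s ^ (r - 2) = z
              generalize r / (r - 2) = w
              field_simp
              ring
  have hVmeas : μ {x | ENNReal.ofReal (s ^ r) ≤ V x} ≤
      ENNReal.ofReal (32 * (r / (r - 2)) / s) * ∫⁻ x, ‖f x‖ₑ ∂μ := by
    have hsr : ENNReal.ofReal (s ^ r) ≠ 0 := by
      rw [Ne, ENNReal.ofReal_eq_zero, not_le]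
      positivity
    rw [← ENNReal.mul_le_mul_iff_right hsr ENNReal.ofReal_ne_top, ← mul_assoc,
      ← ENNReal.ofReal_mul (by positivity)]
    exact (mul_meas_ge_le_lintegral hVm _).trans hVint
  calc μ {x | ENNReal.ofReal s < seqVar r fun n => cellAvg μ c f n x}
      ≤ μ ((⋃ n, {x | ¬ AvgLeUpTo μ c f t n x}) ∪ {x | ENNReal.ofReal (s ^ r) ≤ V x}) := by
        refine measure_mono fun x hx => ?_
        by_cases h : ∀ n, AvgLeUpTo μ c f t n x
        · right
          have heq : (fun n => cellAvg μ c f n x) = fun n => G n x :=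
            funext fun n => (stoppedAvg_eq_cellAvg (h n)).symm
          rw [Set.mem_ofPred_eq, heq] at hx
          rw [Set.mem_ofPred_eq, ← ENNReal.ofReal_rpow_of_pos hs]
          exact (ENNReal.rpow_le_rpow hx.le hr0.le).trans
            (seqVar_rpow_le hr (by positivity) fun n => hGB n x)
        · left
          push Not at h
          exact Set.mem_iUnion.mpr h
    _ ≤ _ := measure_union_le _ _
    _ ≤ ENNReal.ofReal (2 * R / s) * ∫⁻ x, ‖f x‖ₑ ∂μ +
        ENNReal.ofReal (32 * (r / (r - 2)) / s) * ∫⁻ x, ‖f x‖ₑ ∂μ := add_le_add hΩ hVmeas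
    _ ≤ _ := by
        rw [← add_mul, ← ENNReal.ofReal_add (by positivity) (by positivity)]
        gcongr
        have h1 : 1 ≤ r / (r - 2) := by rw [one_le_div hr2]; linarith
        rw [← add_div]
        gcongr
        nlinarith

end IsCellFiltration

/-! ### The maximal function -/

/-- The maximal function of `f` for the cells of the partitions `0, …, L`. -/
noncomputable def maxAvg {X : Type*} [MeasurableSpace X] (μ : Measure X) (c : ℕ → X → Set X)
    (f : X → ℂ) (L : ℕ) (x : X) : ℝ≥0∞ :=
  (Finset.range (L + 1)).sup fun m => (∫⁻ y in c m x, ‖f y‖ₑ ∂μ) / μ (c m x)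

theorem lintegral_rpow_eq_lintegral_measure_ofReal_lt {X : Type*} [MeasurableSpace X]
    {μ : Measure X} {g : X → ℝ≥0∞} (hg : AEMeasurable g μ) (hfin : ∀ x, g x ≠ ∞) {p : ℝ}
    (hp : 0 < p) :
    ∫⁻ x, g x ^ p ∂μ = ENNReal.ofReal p *
      ∫⁻ t in Set.Ioi (0 : ℝ), μ {x | ENNReal.ofReal t < g x} * ENNReal.ofReal (t ^ (p - 1)) := by
  have h := lintegral_rpow_eq_lintegral_meas_lt_mul μ (f := fun x => (g x).toReal)
    (Filter.Eventually.of_forall fun x => ENNReal.toReal_nonneg) hg.ennreal_toReal hp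
  have h1 : ∀ x, ENNReal.ofReal ((g x).toReal ^ p) = g x ^ p := fun x => by
    rw [← ENNReal.ofReal_rpow_of_nonneg ENNReal.toReal_nonneg hp.le, ENNReal.ofReal_toReal (hfin x)]
  simp_rw [h1] at h
  rw [h]
  congr 1
  refine setLIntegral_congr_fun measurableSet_Ioi fun t ht => ?_
  simp only [ENNReal.ofReal_lt_iff_lt_toReal (le_of_lt ht) (hfin _)]

namespace IsCellFiltration

variable {X : Type*} [MeasurableSpace X] {μ : Measure X} {c : ℕ → X → Set X} {R : ℝ}

theorem maxAvg_le_iff (hc : IsCellFiltration μ c R) (f : X → ℂ) {t : ℝ≥0∞} (ht : t ≠ ∞) (L : ℕ)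
    (x : X) : maxAvg μ c f L x ≤ t ↔ AvgLeUpTo μ c f t L x := by
  simp only [maxAvg, AvgLeUpTo, Finset.sup_le_iff, Finset.mem_range, Nat.lt_succ_iff]
  exact forall₂_congr fun m _ =>
    ENNReal.div_le_iff_le_mul (Or.inr ht) (Or.inl (hc.measure_lt_top m x).ne)

theorem measurable_maxAvg (hc : IsCellFiltration μ c R) (f : X → ℂ) (L : ℕ) :
    Measurable (maxAvg μ c f L) := by
  refine hc.measurable_of_const (n := L) fun x y hy => ?_
  refine Finset.sup_congr rfl fun m hm => ?_
  rw [hc.cell_eq (Nat.lt_succ_iff.mp (Finset.mem_range.mp hm)) hy]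

theorem maxAvg_lt_top {f : X → ℂ}
    (hf : ∀ n x, IntegrableOn f (c n x) μ) (L : ℕ) (x : X) : maxAvg μ c f L x < ∞ := by
  refine (Finset.sup_lt_iff ENNReal.zero_lt_top).mpr fun m _ => ?_
  by_cases h0 : μ (c m x) = 0
  · simp [Measure.restrict_eq_zero.mpr h0]
  · exact ENNReal.div_lt_top (hf m x).hasFiniteIntegral.ne h0

theorem enorm_cellAvg_le_maxAvg (hc : IsCellFiltration μ c R) {f : X → ℂ}
    (hf : ∀ n x, IntegrableOn f (c n x) μ) {m L : ℕ} (hm : m ≤ L) (x : X) :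
    ‖cellAvg μ c f m x‖ₑ ≤ maxAvg μ c f L x :=
  hc.enorm_cellAvg_le
    ((hc.maxAvg_le_iff f (maxAvg_lt_top hf L x).ne L x).mp le_rfl m hm)

/-- The part of `f` where `‖f‖ ≤ t` contributes at most `t` to an average, so that averages
exceeding `2 * t` are due to the part where `‖f‖ > t`. -/
theorem mul_measure_lt_maxAvg_le (hc : IsCellFiltration μ c R) (f : X → ℂ) {t : ℝ}
    (ht : 0 < t) (L : ℕ) :
    ENNReal.ofReal t * μ {x | ENNReal.ofReal (2 * t) < maxAvg μ c f L x} ≤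
      μ.withDensity (fun x => ‖f x‖ₑ) {x | ENNReal.ofReal t < ‖f x‖ₑ} := by
  have hset : {x | ENNReal.ofReal (2 * t) < maxAvg μ c f L x} =
      {x | ¬ AvgLeUpTo μ c f (ENNReal.ofReal (2 * t)) L x} := by
    ext x
    simp only [Set.mem_ofPred_eq]
    rw [← hc.maxAvg_le_iff f ENNReal.ofReal_ne_top, not_le]
  rw [hset, ← setLIntegral_const]
  refine (hc.setLIntegral_not_avgLeUpTo_le (f := f)
    (ψ := {x | ENNReal.ofReal t < ‖f x‖ₑ}.indicator fun x => ‖f x‖ₑ) (fun n x h => ?_) L).trans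
    ((setLIntegral_le_lintegral _ _).trans
      ((lintegral_indicator_le _ _).trans (withDensity_apply_le _ _)))
  rw [setLIntegral_const]
  have h1 : ∫⁻ y in c n x, ‖f y‖ₑ ∂μ ≤
      (∫⁻ y in c n x, {x | ENNReal.ofReal t < ‖f x‖ₑ}.indicator (fun x => ‖f x‖ₑ) y ∂μ) +
        ENNReal.ofReal t * μ (c n x) := by
    rw [← setLIntegral_const, ← lintegral_add_right _ measurable_const]
    refine lintegral_mono fun y => ?_
    by_cases hy : ENNReal.ofReal t < ‖f y‖ₑ
    · simp [Set.indicator, hy]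
    · rw [Set.indicator_of_notMem (by exact hy), zero_add]
      exact not_lt.mp hy
  have h2 := h.le.trans h1
  rw [two_mul, ENNReal.ofReal_add ht.le ht.le, add_mul] at h2
  exact (ENNReal.add_le_add_iff_right
    (ENNReal.mul_ne_top ENNReal.ofReal_ne_top (hc.measure_lt_top n x).ne)).mp h2

/-- Doob's maximal inequality on `L^p`. -/
theorem lintegral_maxAvg_rpow_le (hc : IsCellFiltration μ c R) {f : X → ℂ}
    (hfm : AEStronglyMeasurable f μ) (hf : ∀ n x, IntegrableOn f (c n x) μ) {p : ℝ} (hp : 1 < p)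
    (L : ℕ) :
    ∫⁻ x, maxAvg μ c f L x ^ p ∂μ ≤
      ENNReal.ofReal (2 ^ p * (p / (p - 1))) * ∫⁻ x, ‖f x‖ₑ ^ p ∂μ := by
  have hp0 : 0 < p := by linarith
  have hp1 : 0 < p - 1 := by linarith
  have hlc : ∫⁻ x, (maxAvg μ c f L x / 2) ^ p ∂μ ≤
      ENNReal.ofReal (p / (p - 1)) * ∫⁻ x, ‖f x‖ₑ ^ p ∂μ := by
    rw [lintegral_rpow_eq_lintegral_measure_ofReal_lt
      ((hc.measurable_maxAvg f L).div_const 2).aemeasurable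
      (fun x => (ENNReal.div_lt_top (maxAvg_lt_top hf L x).ne two_ne_zero).ne) hp0]
    -- The layer cake formula for `‖f‖ ^ (p - 1)` is applied to the measure with density `‖f‖`.
    have hν := lintegral_rpow_eq_lintegral_measure_ofReal_lt
      (μ := μ.withDensity fun x => ‖f x‖ₑ) (g := fun x => ‖f x‖ₑ)
      (hfm.enorm.mono' (withDensity_absolutelyContinuous μ _)) (fun x => enorm_ne_top) hp1
    rw [lintegral_withDensity_eq_lintegral_mul₀' hfm.enorm
      ((hfm.enorm.mono' (withDensity_absolutelyContinuous μ _)).pow_const _)] at hν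
    have hpow : ∀ x, ((fun x => ‖f x‖ₑ) * fun x => ‖f x‖ₑ ^ (p - 1)) x = ‖f x‖ₑ ^ p := by
      intro x
      simp only [Pi.mul_apply]
      nth_rewrite 1 [← ENNReal.rpow_one ‖f x‖ₑ]
      rw [← ENNReal.rpow_add_of_nonneg _ _ zero_le_one hp1.le]
      congr 1
      ring
    simp_rw [hpow] at hν
    rw [hν, ← mul_assoc, ← ENNReal.ofReal_mul (by positivity), div_mul_cancel₀ _ hp1.ne']
    gcongr ENNReal.ofReal p * ?_
    refine setLIntegral_mono' measurableSet_Ioi fun t ht => ?_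
    have ht0 : 0 < t := ht
    have hset : {x | ENNReal.ofReal t < maxAvg μ c f L x / 2} =
        {x | ENNReal.ofReal (2 * t) < maxAvg μ c f L x} := by
      ext x
      simp only [Set.mem_ofPred_eq]
      rw [ENNReal.lt_div_iff_mul_lt (by simp) (by simp), mul_comm 2 t,
        ENNReal.ofReal_mul ht0.le]
      norm_num
    have hpow' : ENNReal.ofReal (t ^ (p - 1)) =
        ENNReal.ofReal t * ENNReal.ofReal (t ^ (p - 1 - 1)) := by
      rw [← ENNReal.ofReal_mul ht0.le]
      congr 1
      nth_rewrite 2 [← Real.rpow_one t]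
      rw [← Real.rpow_add ht0]
      congr 1
      ring
    rw [hset, hpow', ← mul_assoc, mul_comm (μ _)]
    gcongr
    exact hc.mul_measure_lt_maxAvg_le f ht0 L
  have h2 : ∀ x, maxAvg μ c f L x ^ p = ENNReal.ofReal (2 ^ p) * (maxAvg μ c f L x / 2) ^ p := by
    intro x
    rw [← ENNReal.ofReal_rpow_of_pos two_pos, ← ENNReal.mul_rpow_of_nonneg _ _ hp0.le]
    congr 1
    rw [ENNReal.ofReal_ofNat, ENNReal.mul_div_cancel two_ne_zero ENNReal.ofNat_ne_top]
  simp_rw [h2]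
  rw [lintegral_const_mul _ (((hc.measurable_maxAvg f L).div_const 2).pow_const p),
    ENNReal.ofReal_mul (by positivity), mul_assoc]
  gcongr

/-! ### The good-`λ` inequality -/

theorem measurable_seqVar_min (hc : IsCellFiltration μ c R) (f : X → ℂ) (r : ℝ) (L : ℕ) :
    Measurable fun x => seqVar r fun n => cellAvg μ c f (min n L) x := by
  refine hc.measurable_of_const (n := L) fun x y hy => ?_
  simp only [hc.cellAvg_eq_of_mem f (min_le_right _ L) hy]

theorem cellAvg_indicator (hc : IsCellFiltration μ c R) (f : X → ℂ) {m n : ℕ} (h : m ≤ n)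
    {x y : X} (hy : y ∈ c m x) :
    cellAvg μ c ((c m x).indicator f) n y = cellAvg μ c f n y := by
  have hsub : c n y ⊆ c m x := by
    rw [← hc.eq_of_mem m x y hy]
    exact hc.subset_of_le h y
  rw [cellAvg, cellAvg, setAverage_eq, setAverage_eq,
    setIntegral_congr_fun (hc.measurableSet n y) fun z hz => Set.indicator_of_mem (hsub hz) f]

/-- Good-`λ` inequality. In a cell in which the variation exceeds `s` for the first time, it can
only exceed `2 * s` eventually if the jump into the cell or the variation inside the cell is large.
The first is excluded by the bound on the averages, the second is controlled by the weak type
`(1, 1)` inequality applied to the restriction of `f` to the cell. -/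
theorem measure_goodLambda_le (hc : IsCellFiltration μ c R) {f : X → ℂ}
    (hf : ∀ n x, IntegrableOn f (c n x) μ) {r s γ : ℝ} (hr : 2 < r) (hs : 0 < s) (hγ : 0 < γ)
    (hγ' : γ ≤ 1 / 4) (L : ℕ) :
    μ {x | ENNReal.ofReal (2 * s) < seqVar r (fun n => cellAvg μ c f (min n L) x) ∧
        AvgLeUpTo μ c f (ENNReal.ofReal (γ * s)) L x} ≤
      ENNReal.ofReal (2 * ((2 * R + 32) * (r / (r - 2))) * γ) *
        μ {x | ENNReal.ofReal s < seqVar r fun n => cellAvg μ c f (min n L) x} := by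
  have hR : 0 < R := zero_lt_one.trans_le hc.one_le
  have hr1 : 1 ≤ r := by linarith
  have hr2 : 0 < r - 2 := by linarith
  set E : Set X := {x | ENNReal.ofReal (2 * s) < seqVar r (fun n => cellAvg μ c f (min n L) x) ∧
        AvgLeUpTo μ c f (ENNReal.ofReal (γ * s)) L x} with hE
  set S : ℕ → Set X := fun n =>
    {x | ENNReal.ofReal s < seqVar r fun k => cellAvg μ c f (min k (min n L)) x} with hS
  have hEm : MeasurableSet E :=
    (measurableSet_lt measurable_const (hc.measurable_seqVar_min f r L)).inter
      (hc.measurableSet_of_mem_iff (n := L) fun x y hy => hc.avgLeUpTo_iff f _ hy)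
  have hES : E ⊆ S L := by
    intro x hx
    simp only [hS, Set.mem_ofPred_eq, min_self]
    exact (ENNReal.ofReal_le_ofReal (by linarith)).trans_lt hx.1
  have hcell : ∀ n, ∀ x ∈ S (n + 1), x ∉ S n → μ (E ∩ c (n + 1) x) ≤
      ENNReal.ofReal (2 * ((2 * R + 32) * (r / (r - 2))) * γ) * μ (c (n + 1) x) := by
    intro n x hx hx'
    have hnL : n + 1 ≤ L := by
      by_contra! hcon
      refine hx' ?_
      have e1 : min (n + 1) L = L := by omega
      have e2 : min n L = L := by omega
      simpa only [hS, e1, e2] using hx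
    rcases (E ∩ c (n + 1) x).eq_empty_or_nonempty with h0 | ⟨z, hzE, hz⟩
    · simp [h0]
    have hfx : ∫⁻ y in c (n + 1) x, ‖f y‖ₑ ∂μ ≤ ENNReal.ofReal (γ * s) * μ (c (n + 1) x) := by
      have := hzE.2 (n + 1) hnL
      rwa [hc.eq_of_mem _ x z hz] at this
    set g := (c (n + 1) x).indicator f with hg
    have hgint : Integrable g μ := (hf (n + 1) x).integrable_indicator (hc.measurableSet _ _)
    have hglint : ∫⁻ y, ‖g y‖ₑ ∂μ = ∫⁻ y in c (n + 1) x, ‖f y‖ₑ ∂μ := by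
      rw [← lintegral_indicator (hc.measurableSet _ _)]
      refine lintegral_congr fun y => ?_
      rw [hg, enorm_indicator_eq_indicator_enorm]
    have hsub : E ∩ c (n + 1) x ⊆
        {y | ENNReal.ofReal (s / 2) < seqVar r fun k => cellAvg μ c g k y} := by
      rintro y ⟨hyE, hy⟩
      have hbefore : seqVar r (fun k => cellAvg μ c f (min k n) y) ≤ ENNReal.ofReal s := by
        have hn : min n L = n := by omega
        simp only [hS, Set.mem_ofPred_eq, hn, not_lt] at hx'
        have : (fun k => cellAvg μ c f (min k n) y) = fun k => cellAvg μ c f (min k n) x :=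
          funext fun k => hc.cellAvg_eq_of_mem f ((min_le_right k n).trans n.le_succ) hy
        rwa [this]
      have hjump : ‖cellAvg μ c f (n + 1) y - cellAvg μ c f n y‖ₑ ≤ ENNReal.ofReal (s / 2) := by
        calc ‖cellAvg μ c f (n + 1) y - cellAvg μ c f n y‖ₑ
            ≤ ‖cellAvg μ c f (n + 1) y‖ₑ + ‖cellAvg μ c f n y‖ₑ := enorm_sub_le
          _ ≤ ENNReal.ofReal (γ * s) + ENNReal.ofReal (γ * s) :=
            add_le_add (hc.enorm_cellAvg_le (hyE.2 _ hnL))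
              (hc.enorm_cellAvg_le (hyE.2 _ (n.le_succ.trans hnL)))
          _ ≤ _ := by
            rw [← ENNReal.ofReal_add (by positivity) (by positivity)]
            refine ENNReal.ofReal_le_ofReal ?_
            nlinarith
      have hafter : seqVar r (fun k => cellAvg μ c f (max (n + 1) (min k L)) y) ≤
          seqVar r fun k => cellAvg μ c g k y := by
        have : (fun k => cellAvg μ c f (max (n + 1) (min k L)) y) =
            fun k => cellAvg μ c g (max (n + 1) (min k L)) y :=
          funext fun k => (hc.cellAvg_indicator f (le_max_left _ _) hy).symm
        rw [this]
        exact seqVar_comp_le r (fun k => cellAvg μ c g k y)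
          fun a b hab => max_le_max_left _ (min_le_min_right _ hab)
      by_contra hcon
      rw [Set.mem_ofPred_eq, not_lt] at hcon
      have htot := (seqVar_min_le_split hr1 (fun k => cellAvg μ c f k y) hnL).trans
        (add_le_add (add_le_add hbefore hjump) (hafter.trans hcon))
      rw [← ENNReal.ofReal_add (by positivity) (by positivity),
        ← ENNReal.ofReal_add (by positivity) (by positivity)] at htot
      refine absurd hyE.1 (not_lt.mpr (htot.trans (ENNReal.ofReal_le_ofReal (by linarith))))
    calc μ (E ∩ c (n + 1) x)
        ≤ ENNReal.ofReal ((2 * R + 32) * (r / (r - 2)) / (s / 2)) * ∫⁻ y, ‖g y‖ₑ ∂μ :=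
          (measure_mono hsub).trans (hc.measure_lt_seqVar_le hgint hr (by positivity))
      _ ≤ ENNReal.ofReal ((2 * R + 32) * (r / (r - 2)) / (s / 2)) *
            (ENNReal.ofReal (γ * s) * μ (c (n + 1) x)) := by
          rw [hglint]
          gcongr
      _ = _ := by
          rw [← mul_assoc, ← ENNReal.ofReal_mul (by positivity)]
          congr 2
          generalize (2 * R + 32) * (r / (r - 2)) = w
          field_simp
  have hcover := hc.setLIntegral_le_of_stopping (S := S) (φ := E.indicator 1)
    (ψ := fun _ => ENNReal.ofReal (2 * ((2 * R + 32) * (r / (r - 2))) * γ))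
    (fun n x y hy => by
      have : (fun k => cellAvg μ c f (min k (min n L)) y) =
          fun k => cellAvg μ c f (min k (min n L)) x :=
        funext fun k => hc.cellAvg_eq_of_mem f ((min_le_right _ _).trans (min_le_left _ _)) hy
      simp only [hS, Set.mem_ofPred_eq, this])
    (fun n x hx => lt_of_lt_of_le hx (seqVar_min_mono r (fun k => cellAvg μ c f k x)
      (min_le_min_right L n.le_succ)))
    (fun x hx => by
      simp only [hS, Nat.zero_min, Set.mem_ofPred_eq] at hx
      rw [seqVar_min_zero hr1 (fun k => cellAvg μ c f k x)] at hx
      exact absurd hx not_lt_zero)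
    (fun n x hx hx' => by
      rw [lintegral_indicator_one hEm, setLIntegral_const, Measure.restrict_apply hEm]
      exact hcell n x hx hx') L
  rw [lintegral_indicator_one hEm, setLIntegral_const, Measure.restrict_apply hEm,
    Set.inter_eq_left.mpr hES] at hcover
  simpa only [hS, min_self] using hcover

/-- The `L^p` bound over a finite time horizon. The weak type constant enters linearly, and the
horizon is only used to know that the left-hand side is finite. -/
theorem lintegral_seqVar_min_rpow_le (hc : IsCellFiltration μ c R) {f : X → ℂ}
    (hfm : AEStronglyMeasurable f μ) (hf : ∀ n x, IntegrableOn f (c n x) μ) {p r : ℝ} (hp : 1 < p)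
    (hr : 2 < r) (hfp : ∫⁻ x, ‖f x‖ₑ ^ p ∂μ ≠ ∞) (L : ℕ) :
    ∫⁻ x, (seqVar r fun n => cellAvg μ c f (min n L) x) ^ p ∂μ ≤
      ENNReal.ofReal (2 ^ (p + 1) * (2 ^ (p + 2) * ((2 * R + 32) * (r / (r - 2)))) ^ p *
        (2 ^ p * (p / (p - 1)))) * ∫⁻ x, ‖f x‖ₑ ^ p ∂μ := by
  have hp0 : 0 < p := by linarith
  have hp1 : 0 < p - 1 := by linarith
  have hr1 : 1 ≤ r := by linarith
  have hr2 : 0 < r - 2 := by linarith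
  have hR := hc.one_le
  set W : ℝ := (2 * R + 32) * (r / (r - 2)) with hW
  have hW1 : 1 ≤ W := by
    have h1 : 1 ≤ r / (r - 2) := by rw [one_le_div hr2]; linarith
    nlinarith
  have hW0 : 0 < W := by linarith
  -- The choice of `γ` makes the constant in the good-`λ` inequality equal to `2 ^ (-p) / 2`.
  set γ : ℝ := (2 ^ (p + 2) * W)⁻¹ with hγdef
  have hγ : 0 < γ := by positivity
  have h2p : (4 : ℝ) ≤ 2 ^ (p + 2) := by
    rw [Real.rpow_add two_pos]
    have : (1 : ℝ) ≤ 2 ^ p := Real.one_le_rpow one_le_two hp0.le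
    norm_num
    linarith
  have hγ' : γ ≤ 1 / 4 := by
    rw [hγdef, one_div]
    exact inv_anti₀ (by norm_num) (by nlinarith)
  have hγW : 2 * W * γ = (2 ^ p)⁻¹ / 2 := by
    rw [hγdef, Real.rpow_add two_pos]
    field_simp
    norm_num
  set V : X → ℝ≥0∞ := fun x => seqVar r fun n => cellAvg μ c f (min n L) x with hV
  set M : X → ℝ≥0∞ := maxAvg μ c f L with hM
  have hVm : Measurable V := hc.measurable_seqVar_min f r L
  have hMm : Measurable M := hc.measurable_maxAvg f L
  have hMtop : ∀ x, M x ≠ ∞ := fun x => (maxAvg_lt_top hf L x).ne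
  have hMp : ∫⁻ x, M x ^ p ∂μ ≤
      ENNReal.ofReal (2 ^ p * (p / (p - 1))) * ∫⁻ x, ‖f x‖ₑ ^ p ∂μ :=
    hc.lintegral_maxAvg_rpow_le hfm hf hp L
  have hVM : ∀ x, V x ≤ 2 * L * M x := by
    intro x
    refine (seqVar_min_le_sum hr1 (fun n => cellAvg μ c f n x) L).trans ?_
    calc ∑ i ∈ Finset.range L, ‖cellAvg μ c f (i + 1) x - cellAvg μ c f i x‖ₑ
        ≤ ∑ i ∈ Finset.range L, (M x + M x) := by
          refine Finset.sum_le_sum fun i hi => enorm_sub_le.trans ?_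
          have hiL := Finset.mem_range.mp hi
          exact add_le_add (hc.enorm_cellAvg_le_maxAvg hf hiL x)
            (hc.enorm_cellAvg_le_maxAvg hf hiL.le x)
      _ = 2 * L * M x := by
          rw [Finset.sum_const, Finset.card_range, nsmul_eq_mul]
          ring
  have hLtop : (2 * L : ℝ≥0∞) ≠ ∞ := ENNReal.mul_ne_top ENNReal.ofNat_ne_top
    (ENNReal.natCast_ne_top L)
  have hVtop : ∀ x, V x ≠ ∞ := fun x =>
    ((hVM x).trans_lt (ENNReal.mul_lt_top hLtop.lt_top (hMtop x).lt_top)).ne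
  have hVfin : ∫⁻ x, V x ^ p ∂μ ≠ ∞ := by
    refine (lt_of_le_of_lt (lintegral_mono fun x => ENNReal.rpow_le_rpow (hVM x) hp0.le) ?_).ne
    simp_rw [ENNReal.mul_rpow_of_nonneg _ _ hp0.le]
    rw [lintegral_const_mul _ (hMm.pow_const p)]
    exact ENNReal.mul_lt_top (ENNReal.mul_lt_top
      (ENNReal.rpow_lt_top_of_nonneg hp0.le ENNReal.ofNat_ne_top)
      (ENNReal.rpow_lt_top_of_nonneg hp0.le (ENNReal.natCast_ne_top L)))
      (hMp.trans_lt (ENNReal.mul_lt_top ENNReal.ofReal_lt_top hfp.lt_top))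
  have hdist : ∀ s : ℝ, 0 < s → μ {x | ENNReal.ofReal s < V x / 2} ≤
      ENNReal.ofReal ((2 ^ p)⁻¹ / 2) * μ {x | ENNReal.ofReal s < V x} +
        μ {x | ENNReal.ofReal s < ENNReal.ofReal γ⁻¹ * M x} := by
    intro s hs
    have h1 := hc.measure_goodLambda_le hf hr hs hγ hγ' L
    rw [← hW, hγW] at h1
    refine (measure_mono fun x hx => ?_).trans
      ((measure_union_le _ _).trans (add_le_add h1 le_rfl))
    have hx2 : ENNReal.ofReal (2 * s) < V x := by
      rw [Set.mem_ofPred_eq, ENNReal.lt_div_iff_mul_lt (by simp) (by simp)] at hx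
      rw [mul_comm 2 s, ENNReal.ofReal_mul hs.le]
      simpa using hx
    by_cases hx3 : AvgLeUpTo μ c f (ENNReal.ofReal (γ * s)) L x
    · exact Or.inl ⟨hx2, hx3⟩
    · right
      rw [← hc.maxAvg_le_iff f ENNReal.ofReal_ne_top, not_le] at hx3
      have hγ0 : ENNReal.ofReal γ⁻¹ ≠ 0 := by
        rw [Ne, ENNReal.ofReal_eq_zero, not_le]
        positivity
      have h4 := (ENNReal.mul_lt_mul_iff_right hγ0 ENNReal.ofReal_ne_top).mpr hx3
      rwa [← ENNReal.ofReal_mul (by positivity), inv_mul_cancel_left₀ hγ.ne'] at h4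
  have hint : ∫⁻ x, (V x / 2) ^ p ∂μ ≤ ENNReal.ofReal ((2 ^ p)⁻¹ / 2) * ∫⁻ x, V x ^ p ∂μ +
      ∫⁻ x, (ENNReal.ofReal γ⁻¹ * M x) ^ p ∂μ := by
    rw [lintegral_rpow_eq_lintegral_measure_ofReal_lt (hVm.div_const 2).aemeasurable
        (fun x => (ENNReal.div_lt_top (hVtop x) two_ne_zero).ne) hp0,
      lintegral_rpow_eq_lintegral_measure_ofReal_lt hVm.aemeasurable hVtop hp0,
      lintegral_rpow_eq_lintegral_measure_ofReal_lt (hMm.const_mul _).aemeasurable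
        (fun x => ENNReal.mul_ne_top ENNReal.ofReal_ne_top (hMtop x)) hp0, mul_left_comm, ← mul_add]
    gcongr ENNReal.ofReal p * ?_
    have hanti : Antitone fun t : ℝ => μ {x | ENNReal.ofReal t < V x} := fun a b hab =>
      measure_mono fun x hx => (ENNReal.ofReal_le_ofReal hab).trans_lt hx
    have hmeas : Measurable fun t : ℝ =>
        μ {x | ENNReal.ofReal t < V x} * ENNReal.ofReal (t ^ (p - 1)) :=
      hanti.measurable.mul (Measurable.ennreal_ofReal (measurable_id.pow_const _))
    rw [← lintegral_const_mul _ hmeas, ← lintegral_add_left (hmeas.const_mul _)]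
    refine setLIntegral_mono' measurableSet_Ioi fun t ht => ?_
    rw [← mul_assoc, ← add_mul]
    gcongr
    exact hdist t ht
  have hc2 : ∀ x, (V x / 2) ^ p = ENNReal.ofReal (2 ^ p)⁻¹ * V x ^ p := by
    intro x
    rw [div_eq_mul_inv, ENNReal.mul_rpow_of_nonneg _ _ hp0.le, mul_comm, ENNReal.inv_rpow,
      ENNReal.ofReal_inv_of_pos (by positivity), ← ENNReal.ofReal_rpow_of_pos two_pos,
      ENNReal.ofReal_ofNat]
  have hc3 : ∀ x, (ENNReal.ofReal γ⁻¹ * M x) ^ p = ENNReal.ofReal (γ⁻¹ ^ p) * M x ^ p := by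
    intro x
    rw [ENNReal.mul_rpow_of_nonneg _ _ hp0.le, ENNReal.ofReal_rpow_of_pos (by positivity)]
  simp_rw [hc2, hc3] at hint
  rw [lintegral_const_mul _ (hVm.pow_const p), lintegral_const_mul _ (hMm.pow_const p)] at hint
  have hhalf : ENNReal.ofReal (2 ^ p)⁻¹ =
      ENNReal.ofReal ((2 ^ p)⁻¹ / 2) + ENNReal.ofReal ((2 ^ p)⁻¹ / 2) := by
    rw [← ENNReal.ofReal_add (by positivity) (by positivity), add_halves]
  rw [hhalf, add_mul, ENNReal.add_le_add_iff_left
    (ENNReal.mul_ne_top ENNReal.ofReal_ne_top hVfin)] at hint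
  have hinv : ENNReal.ofReal (2 ^ (p + 1)) * ENNReal.ofReal ((2 ^ p)⁻¹ / 2) = 1 := by
    rw [← ENNReal.ofReal_mul (by positivity), Real.rpow_add two_pos, ENNReal.ofReal_eq_one]
    field_simp
    norm_num
  calc ∫⁻ x, V x ^ p ∂μ
      = ENNReal.ofReal (2 ^ (p + 1)) * (ENNReal.ofReal ((2 ^ p)⁻¹ / 2) * ∫⁻ x, V x ^ p ∂μ) := by
        rw [← mul_assoc, hinv, one_mul]
    _ ≤ ENNReal.ofReal (2 ^ (p + 1)) * (ENNReal.ofReal (γ⁻¹ ^ p) *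
          (ENNReal.ofReal (2 ^ p * (p / (p - 1))) * ∫⁻ x, ‖f x‖ₑ ^ p ∂μ)) := by
        exact mul_le_mul' le_rfl (hint.trans (mul_le_mul' le_rfl hMp))
    _ = _ := by
        rw [← mul_assoc, ← mul_assoc, ← ENNReal.ofReal_mul (by positivity),
          ← ENNReal.ofReal_mul (by positivity), hγdef, inv_inv]

end IsCellFiltration

/-! ### Balls of a homogeneous quasi-norm -/

theorem exp_log_smul_mul_exp_log_inv_smul {d : ℕ} (A : Matrix (Fin d) (Fin d) ℝ) (t : ℝ) :
    NormedSpace.exp (Real.log t • A) * NormedSpace.exp (Real.log t⁻¹ • A) = 1 := by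
  rw [Real.log_inv, neg_smul, Matrix.exp_neg]
  have := (Matrix.isUnit_iff_isUnit_det _).mp (Matrix.isUnit_exp (Real.log t • A))
  exact Matrix.mul_nonsing_inv _ this

theorem toEuclideanLin_toEuclideanLin_of_mul_eq_one {d : ℕ} {M N : Matrix (Fin d) (Fin d) ℝ}
    (h : M * N = 1) (x : EuclideanSpace ℝ (Fin d)) :
    Matrix.toEuclideanLin M (Matrix.toEuclideanLin N x) = x := by
  rw [Matrix.toLpLin_apply, Matrix.toLpLin_apply, Matrix.mulVec_mulVec, h, Matrix.one_mulVec]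

theorem dilation_dilation_inv {d : ℕ} (A : Matrix (Fin d) (Fin d) ℝ) (t : ℝ)
    (x : EuclideanSpace ℝ (Fin d)) : dilation A t (dilation A t⁻¹ x) = x :=
  toEuclideanLin_toEuclideanLin_of_mul_eq_one (exp_log_smul_mul_exp_log_inv_smul A t) x

namespace IsHomogeneousQuasiNorm

variable {d : ℕ} {A : Matrix (Fin d) (Fin d) ℝ} {ρ : EuclideanSpace ℝ (Fin d) → ℝ}

/-- The ball of radius `s * r` is contained in the image under `s ^ A` of the ball of radius `r`. -/
theorem volume_lt_mul_le (hρ : IsHomogeneousQuasiNorm A ρ) {s : ℝ} (hs : 0 < s) (r : ℝ) :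
    volume {x | ρ x < s * r} ≤
      ENNReal.ofReal |LinearMap.det (Matrix.toEuclideanLin (NormedSpace.exp (Real.log s • A)))| *
        volume {x | ρ x < r} := by
  rw [← Measure.addHaar_image_linearMap]
  refine measure_mono fun x hx => ⟨dilation A s⁻¹ x, ?_, dilation_dilation_inv A s x⟩
  rw [Set.mem_ofPred_eq, hρ.homogeneous _ (inv_pos.mpr hs), inv_mul_lt_iff₀ hs]
  exact hx

/-- A homogeneous quasi-norm is bounded away from zero outside the unit ball. Since `ρ` is bounded
on the unit ball and positive on the unit sphere, some dilation `T ^ A` with `T ≥ 1` increases all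
norms, so that, by compactness, its inverse is a strict contraction. Iterates of the inverse
decrease `ρ` and move every point outside the unit ball into a fixed compact shell. -/
theorem exists_pos_le (hρ : IsHomogeneousQuasiNorm A ρ) :
    ∃ m : ℝ, 0 < m ∧ ∀ x, 1 ≤ ‖x‖ → m ≤ ρ x := by
  have hpos : ∀ x, x ≠ 0 → 0 < ρ x := fun x hx =>
    lt_of_le_of_ne (hρ.nonneg x) fun h => hx ((hρ.eq_zero_iff x).mp h.symm)
  have hne : ∀ x : EuclideanSpace ℝ (Fin d), 1 ≤ ‖x‖ → x ≠ 0 := fun x hx h0 => by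
    rw [h0, norm_zero] at hx
    linarith
  obtain ⟨M, hM⟩ := (isCompact_closedBall (0 : EuclideanSpace ℝ (Fin d))
    1).exists_bound_of_continuousOn hρ.continuous.continuousOn
  obtain ⟨m₀, hm₀, hm⟩ := (isCompact_sphere (0 : EuclideanSpace ℝ (Fin d)) 1).exists_forall_le'
    hρ.continuous.continuousOn (a := 0) fun x hx =>
      hpos x (hne x (by rw [mem_sphere_zero_iff_norm] at hx; exact hx.ge))
  set T : ℝ := max 1 ((M + 1) / m₀)
  have hT1 : 1 ≤ T := le_max_left _ _
  have hT0 : 0 < T := by linarith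
  have hTm : M < T * m₀ := by
    have := (div_le_iff₀ hm₀).mp (le_max_right 1 ((M + 1) / m₀))
    linarith
  have hlin : ∀ (t c : ℝ) x, dilation A t (c • x) = c • dilation A t x :=
    fun t c x => map_smul _ c x
  have hexp : ∀ x, x ≠ 0 → ‖x‖ < ‖dilation A T x‖ := by
    intro x hx
    have hx0 : 0 < ‖x‖ := norm_pos_iff.mpr hx
    by_contra! hcon
    have hball : dilation A T (‖x‖⁻¹ • x) ∈ Metric.closedBall (0 : EuclideanSpace ℝ (Fin d)) 1 := by
      rw [mem_closedBall_zero_iff, hlin, norm_smul, norm_inv, norm_norm, inv_mul_le_iff₀ hx0,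
        mul_one]
      exact hcon
    have hsph : ‖x‖⁻¹ • x ∈ Metric.sphere (0 : EuclideanSpace ℝ (Fin d)) 1 := by
      rw [mem_sphere_zero_iff_norm, norm_smul, norm_inv, norm_norm, inv_mul_cancel₀ hx0.ne']
    have h1 := hM _ hball
    rw [hρ.homogeneous T hT0, Real.norm_eq_abs] at h1
    have h2 := (le_abs_self _).trans h1
    have h3 := mul_le_mul_of_nonneg_left (hm _ hsph) hT0.le
    linarith
  have hcancel : ∀ x, dilation A T (dilation A T⁻¹ x) = x := dilation_dilation_inv A T
  have hzero : ∀ t, dilation A t 0 = 0 := fun t => map_zero _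
  have hcontr : ∀ x, x ≠ 0 → ‖dilation A T⁻¹ x‖ < ‖x‖ := by
    intro x hx
    have := hexp (dilation A T⁻¹ x) fun h0 => hx (by rw [← hcancel x, h0, hzero])
    rwa [hcancel] at this
  have hcont : ∀ t, Continuous (dilation A t) := fun t =>
    (Matrix.toEuclideanLin (NormedSpace.exp (Real.log t • A))).continuous_of_finiteDimensional
  obtain ⟨a, ha, hasph⟩ :=
    (isCompact_sphere (0 : EuclideanSpace ℝ (Fin d)) 1).exists_forall_le'
      (f := fun x => 1 - ‖dilation A T⁻¹ x‖) (a := 0)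
      (continuous_const.sub (hcont T⁻¹).norm).continuousOn fun x hx => by
        rw [mem_sphere_zero_iff_norm] at hx
        have := hcontr x (hne x hx.ge)
        linarith
  set q : ℝ := max 0 (1 - a)
  have hq0 : 0 ≤ q := le_max_left _ _
  have hq1 : q < 1 := max_lt one_pos (by linarith)
  have hqle : ∀ x, ‖dilation A T⁻¹ x‖ ≤ q * ‖x‖ := by
    intro x
    by_cases hx : x = 0
    · simp [hx, hzero]
    have hx0 : 0 < ‖x‖ := norm_pos_iff.mpr hx
    have hsph : ‖x‖⁻¹ • x ∈ Metric.sphere (0 : EuclideanSpace ℝ (Fin d)) 1 := by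
      rw [mem_sphere_zero_iff_norm, norm_smul, norm_inv, norm_norm, inv_mul_cancel₀ hx0.ne']
    have h1 := hasph _ hsph
    rw [hlin, norm_smul, norm_inv, norm_norm] at h1
    have h2 : ‖x‖⁻¹ * ‖dilation A T⁻¹ x‖ ≤ q := le_trans (by linarith) (le_max_right 0 (1 - a))
    rwa [inv_mul_le_iff₀ hx0, mul_comm] at h2
  set C : ℝ := max 1 ‖LinearMap.toContinuousLinearMap
    (Matrix.toEuclideanLin (NormedSpace.exp (Real.log T • A)))‖
  have hC0 : 0 < C := one_pos.trans_le (le_max_left _ _)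
  have hCle : ∀ x, ‖dilation A T x‖ ≤ C * ‖x‖ := fun x =>
    ((LinearMap.toContinuousLinearMap
      (Matrix.toEuclideanLin (NormedSpace.exp (Real.log T • A)))).le_opNorm x).trans
      (mul_le_mul_of_nonneg_right (le_max_right _ _) (norm_nonneg x))
  have hshell : IsCompact {x : EuclideanSpace ℝ (Fin d) | 1 ≤ ‖x‖ ∧ ‖x‖ ≤ C} := by
    refine (isCompact_closedBall (0 : EuclideanSpace ℝ (Fin d)) C).of_isClosed_subset
      ((isClosed_le continuous_const continuous_norm).inter
        (isClosed_le continuous_norm continuous_const)) fun x hx => ?_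
    rw [mem_closedBall_zero_iff]
    exact hx.2
  obtain ⟨m, hm0, hmshell⟩ := hshell.exists_forall_le' hρ.continuous.continuousOn (a := 0)
    fun x hx => hpos x (hne x hx.1)
  refine ⟨m, hm0, fun x hx => ?_⟩
  have hiter : ∀ (n : ℕ) (x : EuclideanSpace ℝ (Fin d)), 1 ≤ ‖x‖ → ‖x‖ * q ^ n ≤ C → m ≤ ρ x := by
    intro n
    induction n with
    | zero => exact fun x hx hxn => hmshell x ⟨hx, by simpa using hxn⟩
    | succ n ih =>
      intro x hx hxn
      rcases le_or_gt ‖x‖ C with hxC | hxC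
      · exact hmshell x ⟨hx, hxC⟩
      have h1 : 1 ≤ ‖dilation A T⁻¹ x‖ := by
        have := hCle (dilation A T⁻¹ x)
        rw [hcancel] at this
        by_contra! hcon
        nlinarith
      have h2 : ‖dilation A T⁻¹ x‖ * q ^ n ≤ C := by
        refine le_trans (mul_le_mul_of_nonneg_right (hqle x) (by positivity)) ?_
        calc q * ‖x‖ * q ^ n = ‖x‖ * q ^ (n + 1) := by ring
          _ ≤ C := hxn
      have h3 := ih _ h1 h2
      have h4 := hρ.homogeneous T hT0 (dilation A T⁻¹ x)
      rw [hcancel] at h4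
      rw [h4]
      nlinarith
  have hx0 : 0 < ‖x‖ := by linarith
  obtain ⟨n, hn⟩ := exists_pow_lt_of_lt_one (div_pos hC0 hx0) hq1
  refine hiter n x hx ?_
  rw [lt_div_iff₀ hx0] at hn
  linarith

theorem volume_lt_lt_top (hρ : IsHomogeneousQuasiNorm A ρ) {r : ℝ} (hr : 0 < r) :
    volume {x | ρ x < r} < ∞ := by
  obtain ⟨m, hm, hmle⟩ := hρ.exists_pos_le
  have h1 : volume {x | ρ x < m} < ∞ := by
    refine lt_of_le_of_lt (measure_mono fun x hx => ?_)
      (measure_ball_lt_top (x := (0 : EuclideanSpace ℝ (Fin d))) (r := 1))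
    rw [mem_ball_zero_iff]
    by_contra! hcon
    exact absurd hx (not_lt.mpr (hmle x hcon))
  have h2 := hρ.volume_lt_mul_le (div_pos hr hm) m
  rw [div_mul_cancel₀ _ hm.ne'] at h2
  exact h2.trans_lt (ENNReal.mul_lt_top ENNReal.ofReal_lt_top h1)

theorem volume_quasiBall (ρ : EuclideanSpace ℝ (Fin d) → ℝ) (z : EuclideanSpace ℝ (Fin d)) (r : ℝ) :
    volume (quasiBall ρ z r) = volume {x | ρ x < r} := by
  have : quasiBall ρ z r = (fun x => x + -z) ⁻¹' {x | ρ x < r} := by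
    ext x
    simp [quasiBall, sub_eq_add_neg]
  rw [this, measure_preimage_add_right]

end IsHomogeneousQuasiNorm

/-! ### The cells defined by dyadic cubes -/

section Cubes

variable {d : ℕ} {A : Matrix (Fin d) (Fin d) ℝ} {ρ : EuclideanSpace ℝ (Fin d) → ℝ}
  {ι : ℤ → Type*} {Q : (k : ℤ) → ι k → Set (EuclideanSpace ℝ (Fin d))}

namespace IsDyadicCubeSystem

theorem disjoint (hQ : IsDyadicCubeSystem ρ Q) {k : ℤ} {α β : ι k} (h : α ≠ β) :
    Disjoint (Q k α) (Q k β) := by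
  obtain ⟨_, D, δ, η, C₁, C₂, -, -, -, -, -, -, hnest, huniq, -⟩ := hQ
  refine (hnest k k le_rfl α β).resolve_left fun hsub => h ?_
  exact (huniq k k le_rfl α).unique subset_rfl hsub

theorem eq_of_mem (hQ : IsDyadicCubeSystem ρ Q) {k : ℤ} {α β : ι k} {x : EuclideanSpace ℝ (Fin d)}
    (hα : x ∈ Q k α) (hβ : x ∈ Q k β) : α = β := by
  by_contra h
  exact Set.disjoint_left.mp (hQ.disjoint h) hα hβ

theorem nonempty (hQ : IsDyadicCubeSystem ρ Q) (hρ : IsHomogeneousQuasiNorm A ρ) (k : ℤ) (α : ι k) :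
    (Q k α).Nonempty := by
  obtain ⟨_, D, δ, η, C₁, C₂, hD, hδ, -, -, -, -, -, -, hball, -⟩ := hQ
  obtain ⟨⟨z, hz⟩, -⟩ := hball k α
  refine ⟨z, hz ?_⟩
  have : ρ 0 = 0 := (hρ.eq_zero_iff 0).mpr rfl
  simp only [quasiBall, Set.mem_ofPred_eq, sub_self, this]
  have : 0 < D := by linarith
  positivity

theorem countable (hQ : IsDyadicCubeSystem ρ Q) (hρ : IsHomogeneousQuasiNorm A ρ) (k : ℤ) :
    Countable (ι k) :=
  Pairwise.countable_of_isOpen_disjoint (fun _ _ h => hQ.disjoint h) (hQ.1 k) (hQ.nonempty hρ k)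

/-- Cubes have finite measure, and the measures of cubes of consecutive levels are comparable. -/
theorem exists_volume_le (hQ : IsDyadicCubeSystem ρ Q) (hρ : IsHomogeneousQuasiNorm A ρ) :
    (∀ k α, volume (Q k α) < ∞) ∧ ∃ R : ℝ, 1 ≤ R ∧
      ∀ k α β, volume (Q (k + 1) α) ≤ ENNReal.ofReal R * volume (Q k β) := by
  have hne := hQ.nonempty hρ
  obtain ⟨_, D, δ, η, C₁, C₂, hD, hδ, -, hC₁, -, -, -, -, hball, -⟩ := hQ
  have hD0 : 0 < D := by linarith
  have hupper : ∀ k α, volume (Q k α) ≤ volume {x | ρ x < (C₁ + 1) * D ^ k} := by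
    intro k α
    obtain ⟨w, hw⟩ := hne k α
    rw [← IsHomogeneousQuasiNorm.volume_quasiBall ρ w]
    refine measure_mono fun x hx => ?_
    have h1 : ENNReal.ofReal (ρ (x - w)) ≤ quasiDiam ρ (Q k α) :=
      le_iSup₂_of_le x hx (le_iSup₂_of_le w hw le_rfl)
    have h2 := h1.trans (hball k α).2
    have hDk : 0 < D ^ k := zpow_pos hD0 k
    rw [ENNReal.ofReal_le_ofReal_iff (by positivity)] at h2
    simp only [quasiBall, Set.mem_ofPred_eq]
    linarith
  refine ⟨fun k α => (hupper k α).trans_lt (hρ.volume_lt_lt_top ?_), ?_⟩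
  · have hDk : 0 < D ^ k := zpow_pos hD0 k
    positivity
  set s : ℝ := (C₁ + 1) * D / δ with hs
  refine ⟨max 1 |LinearMap.det (Matrix.toEuclideanLin (NormedSpace.exp (Real.log s • A)))|,
    le_max_left _ _, fun k α β => ?_⟩
  obtain ⟨⟨z, hz⟩, -⟩ := hball k β
  calc volume (Q (k + 1) α) ≤ volume {x | ρ x < (C₁ + 1) * D ^ (k + 1)} := hupper _ _
    _ = volume {x | ρ x < s * (δ * D ^ k)} := by
        have : (C₁ + 1) * D ^ (k + 1) = s * (δ * D ^ k) := by
          rw [hs, zpow_add_one₀ hD0.ne']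
          field_simp
        rw [this]
    _ ≤ _ := hρ.volume_lt_mul_le (by positivity) _
    _ ≤ _ := by
        refine mul_le_mul' (ENNReal.ofReal_le_ofReal (le_max_right _ _)) ?_
        rw [← IsHomogeneousQuasiNorm.volume_quasiBall ρ z]
        exact measure_mono hz

end IsDyadicCubeSystem

/-- The set of points that lie in a cube of every level. -/
def cubeCore (Q : (k : ℤ) → ι k → Set (EuclideanSpace ℝ (Fin d))) :
    Set (EuclideanSpace ℝ (Fin d)) :=
  ⋂ k, ⋃ α, Q k α

/-- The cell of `x` at time `k`: the part of the cube of level `-k` containing `x` that lies in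
`cubeCore Q`. The exceptional null set, the complement of `cubeCore Q`, is a cell at all times. -/
def cubeCell (Q : (k : ℤ) → ι k → Set (EuclideanSpace ℝ (Fin d))) (k : ℤ)
    (x : EuclideanSpace ℝ (Fin d)) : Set (EuclideanSpace ℝ (Fin d)) :=
  {y | (x ∈ cubeCore Q ∧ y ∈ cubeCore Q ∧ ∃ α, x ∈ Q (-k) α ∧ y ∈ Q (-k) α) ∨
    (x ∉ cubeCore Q ∧ y ∉ cubeCore Q)}

theorem exists_mem_of_mem_cubeCore {x : EuclideanSpace ℝ (Fin d)} (hx : x ∈ cubeCore Q) (k : ℤ) :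
    ∃ α, x ∈ Q k α := by
  simpa using Set.mem_iInter.mp hx k

theorem cubeCell_of_notMem {k : ℤ} {x : EuclideanSpace ℝ (Fin d)} (hx : x ∉ cubeCore Q) :
    cubeCell Q k x = (cubeCore Q)ᶜ := by
  ext y
  simp [cubeCell, hx]

namespace IsDyadicCubeSystem

theorem cubeCell_eq (hQ : IsDyadicCubeSystem ρ Q) {k : ℤ} {x : EuclideanSpace ℝ (Fin d)}
    (hx : x ∈ cubeCore Q) {α : ι (-k)} (hα : x ∈ Q (-k) α) :
    cubeCell Q k x = Q (-k) α ∩ cubeCore Q := by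
  ext y
  simp only [cubeCell, hx, true_and, not_true, false_and, or_false, Set.mem_ofPred_eq,
    Set.mem_inter_iff]
  constructor
  · rintro ⟨hy, β, hβ, hyβ⟩
    obtain rfl := hQ.eq_of_mem hα hβ
    exact ⟨hyβ, hy⟩
  · exact fun ⟨hyα, hy⟩ => ⟨hy, α, hα, hyα⟩

theorem measurableSet_cubeCore (hQ : IsDyadicCubeSystem ρ Q) : MeasurableSet (cubeCore Q) :=
  MeasurableSet.iInter fun k => (isOpen_iUnion (hQ.1 k)).measurableSet

theorem volume_compl_cubeCore (hQ : IsDyadicCubeSystem ρ Q) : volume (cubeCore Q)ᶜ = 0 := by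
  obtain ⟨_, D, δ, η, C₁, C₂, -, -, -, -, -, hnull, -⟩ := hQ
  rw [cubeCore, Set.compl_iInter]
  exact measure_iUnion_null hnull

theorem ae_mem_cubeCore (hQ : IsDyadicCubeSystem ρ Q) : ∀ᵐ x, x ∈ cubeCore Q :=
  hQ.volume_compl_cubeCore

theorem volume_cubeCell (hQ : IsDyadicCubeSystem ρ Q) {k : ℤ} {x : EuclideanSpace ℝ (Fin d)}
    (hx : x ∈ cubeCore Q) {α : ι (-k)} (hα : x ∈ Q (-k) α) :
    volume (cubeCell Q k x) = volume (Q (-k) α) := by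
  rw [hQ.cubeCell_eq hx hα]
  exact measure_inter_conull hQ.volume_compl_cubeCore

theorem cubeCell_succ_subset (hQ : IsDyadicCubeSystem ρ Q) (k : ℤ)
    (x : EuclideanSpace ℝ (Fin d)) : cubeCell Q (k + 1) x ⊆ cubeCell Q k x := by
  by_cases hx : x ∈ cubeCore Q
  · obtain ⟨β, hβ⟩ := exists_mem_of_mem_cubeCore hx (-(k + 1))
    obtain ⟨_, D, δ, η, C₁, C₂, -, -, -, -, -, -, -, huniq, -⟩ := id hQ
    obtain ⟨α, hα, -⟩ := huniq (-(k + 1)) (-k) (by omega) β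
    rw [hQ.cubeCell_eq hx hβ, hQ.cubeCell_eq hx (hα hβ)]
    exact Set.inter_subset_inter_left _ hα
  · rw [cubeCell_of_notMem hx, cubeCell_of_notMem hx]

theorem cubeCell_eq_of_mem (hQ : IsDyadicCubeSystem ρ Q) (k : ℤ)
    {x y : EuclideanSpace ℝ (Fin d)} (hy : y ∈ cubeCell Q k x) :
    cubeCell Q k y = cubeCell Q k x := by
  rcases hy with ⟨hx, hy, α, hxα, hyα⟩ | ⟨hx, hy⟩
  · rw [hQ.cubeCell_eq hx hxα, hQ.cubeCell_eq hy hyα]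
  · rw [cubeCell_of_notMem hx, cubeCell_of_notMem hy]

/-- For each `N`, the cubes of level at most `N` give a filtration that starts at level `N`. The
bound `R` for the ratio of the measures of successive cells does not depend on `N`. -/
theorem exists_isCellFiltration (hQ : IsDyadicCubeSystem ρ Q) (hρ : IsHomogeneousQuasiNorm A ρ) :
    ∃ R : ℝ, 1 ≤ R ∧ ∀ N : ℕ,
      IsCellFiltration volume (fun (n : ℕ) x => cubeCell Q ((n : ℤ) - N) x) R := by
  obtain ⟨hfin, R, hR, hle⟩ := hQ.exists_volume_le hρ
  have := hQ.countable hρ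
  have hcast : ∀ n N : ℕ, ((n + 1 : ℕ) : ℤ) - N = ((n : ℤ) - N) + 1 := fun n N => by
    push_cast
    ring
  refine ⟨R, hR, fun N => ⟨fun n x => ?_, fun n x y => hQ.cubeCell_eq_of_mem _, fun n x => ?_,
    fun n x => ?_, fun n => ?_, fun n x => ?_, hR, fun n x => ?_⟩⟩
  · by_cases hx : x ∈ cubeCore Q
    · obtain ⟨α, hα⟩ := exists_mem_of_mem_cubeCore hx (-((n : ℤ) - N))
      rw [hQ.cubeCell_eq hx hα]
      exact ⟨hα, hx⟩
    · rw [cubeCell_of_notMem hx]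
      exact hx
  · rw [hcast]
    exact hQ.cubeCell_succ_subset _ x
  · by_cases hx : x ∈ cubeCore Q
    · obtain ⟨α, hα⟩ := exists_mem_of_mem_cubeCore hx (-((n : ℤ) - N))
      rw [hQ.cubeCell_eq hx hα]
      exact (hQ.1 _ α).measurableSet.inter hQ.measurableSet_cubeCore
    · rw [cubeCell_of_notMem hx]
      exact hQ.measurableSet_cubeCore.compl
  · refine ((Set.countable_range fun α => Q (-((n : ℤ) - N)) α ∩ cubeCore Q).union
      (Set.countable_singleton (cubeCore Q)ᶜ)).mono ?_
    rintro _ ⟨x, rfl⟩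
    by_cases hx : x ∈ cubeCore Q
    · obtain ⟨α, hα⟩ := exists_mem_of_mem_cubeCore hx (-((n : ℤ) - N))
      exact Or.inl ⟨α, (hQ.cubeCell_eq hx hα).symm⟩
    · exact Or.inr (cubeCell_of_notMem hx)
  · by_cases hx : x ∈ cubeCore Q
    · obtain ⟨α, hα⟩ := exists_mem_of_mem_cubeCore hx (-((n : ℤ) - N))
      rw [hQ.volume_cubeCell hx hα]
      exact hfin _ α
    · rw [cubeCell_of_notMem hx, hQ.volume_compl_cubeCore]
      exact ENNReal.zero_lt_top
  · rw [hcast]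
    by_cases hx : x ∈ cubeCore Q
    · obtain ⟨α, hα⟩ := exists_mem_of_mem_cubeCore hx (-((n : ℤ) - N))
      obtain ⟨β, hβ⟩ := exists_mem_of_mem_cubeCore hx (-((n : ℤ) - N + 1))
      rw [hQ.volume_cubeCell hx hα, hQ.volume_cubeCell hx hβ]
      have h := hle (-((n : ℤ) - N + 1))
      rw [show -((n : ℤ) - N + 1) + 1 = -((n : ℤ) - N) by ring] at h
      exact h α β
    · rw [cubeCell_of_notMem hx, hQ.volume_compl_cubeCore]
      exact zero_le

theorem dyadicExpectation_eq (hQ : IsDyadicCubeSystem ρ Q) (f : EuclideanSpace ℝ (Fin d) → ℂ)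
    (k : ℤ) {x : EuclideanSpace ℝ (Fin d)} (hx : x ∈ cubeCore Q) :
    dyadicExpectation Q f k x = ⨍ y in cubeCell Q k x, f y := by
  obtain ⟨α, hα⟩ := exists_mem_of_mem_cubeCore hx (-k)
  rw [dyadicExpectation, tsum_eq_single α, Set.indicator_of_mem hα, hQ.cubeCell_eq hx hα]
  · refine setAverage_congr ?_
    filter_upwards [hQ.ae_mem_cubeCore] with y hy
    exact propext ⟨fun h => ⟨h, hy⟩, fun h => h.1⟩
  · intro β hβ
    refine Set.indicator_of_notMem (fun h => hβ (hQ.eq_of_mem h hα)) _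

end IsDyadicCubeSystem

end Cubes

/-! ### From finite time horizons to all integers -/

theorem seqVar_window_mono (r : ℝ) (a : ℤ → ℂ) :
    Monotone fun N : ℕ => seqVar r fun n : ℕ => a ((min n (2 * N) : ℕ) - N) := by
  refine monotone_nat_of_le_succ fun N => ?_
  have h := seqVar_comp_le r (fun n : ℕ => a ((min n (2 * (N + 1)) : ℕ) - (N + 1 : ℕ)))
    (φ := fun n => min n (2 * N) + 1) fun m n h => Nat.add_le_add_right (min_le_min_right _ h) 1
  refine le_trans (le_of_eq ?_) h
  congr 1
  funext n
  congr 1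
  have : min (min n (2 * N) + 1) (2 * (N + 1)) = min n (2 * N) + 1 := by omega
  rw [this]
  push_cast
  ring

/-- The variation over `ℤ` is the limit of the variations over the windows `[-N, N]`, which are
reindexed by `ℕ` through `n ↦ min n (2 * N) - N`. -/
theorem rVariation_le_iSup_seqVar (r : ℝ) (a : ℤ → ℂ) :
    rVariation r a ≤ ⨆ N : ℕ, seqVar r fun n : ℕ => a ((min n (2 * N) : ℕ) - N) := by
  refine iSup_le fun J => iSup_le fun k => iSup_le fun hk => ?_
  obtain ⟨N, hN⟩ : ∃ N : ℕ, ∀ j, -(N : ℤ) ≤ k j ∧ k j ≤ N := by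
    refine ⟨max (k 0).natAbs (k (Fin.last J)).natAbs, fun j => ?_⟩
    have h1 := hk.monotone (Fin.zero_le j)
    have h2 := hk.monotone (Fin.le_last j)
    omega
  refine le_iSup_of_le N ?_
  -- The index sequence is shifted by `N` and extended by its last value.
  have hu : Monotone fun i : ℕ => (k ⟨min i J, by omega⟩ + N).toNat := by
    intro i j hij
    refine Int.toNat_le_toNat (add_le_add_left (hk.monotone ?_) _)
    exact min_le_min_right _ hij
  have hval : ∀ i : Fin (J + 1),
      a ((min (k ⟨min (i : ℕ) J, by omega⟩ + N).toNat (2 * N) : ℕ) - (N : ℤ)) = a (k i) := by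
    intro i
    have hi : (⟨min (i : ℕ) J, by omega⟩ : Fin (J + 1)) = i := by
      ext
      simp only
      omega
    rw [hi]
    congr 1
    have := hN i
    omega
  refine le_trans (le_of_eq ?_)
    (le_seqVar r (fun n : ℕ => a ((min n (2 * N) : ℕ) - (N : ℤ))) J hu)
  rw [Finset.sum_range]
  congr 1
  refine Finset.sum_congr rfl fun j _ => ?_
  have h1 := hval j.succ
  have h2 := hval j.castSucc
  simp only [Fin.val_succ, Fin.val_castSucc] at h1 h2
  rw [h1, h2]

theorem measurable_rVariation {X : Type*} [MeasurableSpace X] {F : ℤ → X → ℂ}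
    (hF : ∀ k, Measurable (F k)) (r : ℝ) : Measurable fun x => rVariation r fun k => F k x := by
  unfold rVariation
  exact Measurable.iSup fun J => Measurable.iSup fun k => Measurable.iSup fun _ =>
    Measurable.pow_const (Finset.measurable_sum _ fun j _ =>
      Measurable.pow_const ((hF _).sub (hF _)).enorm _) _

theorem mainTheorem8 {d : ℕ} (A : Matrix (Fin d) (Fin d) ℝ) (hA : IsDilationGenerator A)
    (ρ : EuclideanSpace ℝ (Fin d) → ℝ) (hρ : IsHomogeneousQuasiNorm A ρ)
    {ι : ℤ → Type*} (Q : (k : ℤ) → ι k → Set (EuclideanSpace ℝ (Fin d)))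
    (hQ : IsDyadicCubeSystem ρ Q) :
    (∀ p : ℝ, 1 < p → ∃ C : ℝ, 0 < C ∧ ∀ r : ℝ, 2 < r →
      ∀ f : EuclideanSpace ℝ (Fin d) → ℂ, MemLp f (ENNReal.ofReal p) volume →
        AEMeasurable (dyadicVariation Q r f) volume ∧
        eLpNorm (dyadicVariation Q r f) (ENNReal.ofReal p) volume ≤
          ENNReal.ofReal (C * (r / (r - 2))) * eLpNorm f (ENNReal.ofReal p) volume) ∧
    (∀ r : ℝ, 2 < r → ∃ C : ℝ, 0 < C ∧
      ∀ f : EuclideanSpace ℝ (Fin d) → ℂ, MemLp f 1 volume → ∀ s : ℝ, 0 < s →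
        volume {x | ENNReal.ofReal s < dyadicVariation Q r f x} ≤
          ENNReal.ofReal (C / s) * eLpNorm f 1 volume) := by
  obtain ⟨R, hR, hc⟩ := hQ.exists_isCellFiltration hρ
  set c : ℕ → ℕ → EuclideanSpace ℝ (Fin d) → Set (EuclideanSpace ℝ (Fin d)) :=
    fun N n x => cubeCell Q ((n : ℤ) - N) x
  have hvar : ∀ (r : ℝ) (f : EuclideanSpace ℝ (Fin d) → ℂ), ∀ᵐ x, dyadicVariation Q r f x =
      rVariation r fun k => ⨍ y in cubeCell Q k x, f y := by
    intro r f
    filter_upwards [hQ.ae_mem_cubeCore] with x hx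
    simp only [dyadicVariation, hQ.dyadicExpectation_eq f _ hx]
  have hsup : ∀ (r : ℝ) (f : EuclideanSpace ℝ (Fin d) → ℂ), ∀ᵐ x, dyadicVariation Q r f x ≤
      ⨆ N : ℕ, seqVar r fun n => cellAvg volume (c N) f (min n (2 * N)) x := by
    intro r f
    filter_upwards [hvar r f] with x hx
    rw [hx]
    exact rVariation_le_iSup_seqVar r _
  have hmono : ∀ (r : ℝ) (f : EuclideanSpace ℝ (Fin d) → ℂ), Monotone fun (N : ℕ) x =>
      seqVar r fun n => cellAvg volume (c N) f (min n (2 * N)) x := fun r f M N h x =>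
    seqVar_window_mono r (fun k => ⨍ y in cubeCell Q k x, f y) h
  constructor
  · intro p hp
    have hp0 : 0 < p := by linarith
    have hp1 : 0 < p - 1 := by linarith
    refine ⟨(2 ^ (p + 1) * (2 ^ p * (p / (p - 1)))) ^ (1 / p) * (2 ^ (p + 2) * (2 * R + 32)),
      by positivity, fun r hr f hf => ⟨?_, ?_⟩⟩
    · refine AEMeasurable.congr (measurable_rVariation
        (F := fun k x => ⨍ y in cubeCell Q k x, f y) (fun k => ?_) r).aemeasurable
        ((hvar r f).mono fun x hx => hx.symm)
      have h : Measurable fun x =>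
          ⨍ y in cubeCell Q (((k + k.natAbs).toNat : ℕ) - k.natAbs) x, f y :=
        (hc k.natAbs).measurable_cellAvg f (k + k.natAbs).toNat
      have hk : (((k + k.natAbs).toNat : ℕ) : ℤ) - k.natAbs = k := by omega
      rwa [hk] at h
    have hr2 : 0 < r - 2 := by linarith
    have hpne : ENNReal.ofReal p ≠ 0 := by simpa using hp0
    have hfp : ∫⁻ x, ‖f x‖ₑ ^ p ≠ ∞ := by
      have := lintegral_rpow_enorm_lt_top_of_eLpNorm_lt_top hpne ENNReal.ofReal_ne_top hf.2
      rw [ENNReal.toReal_ofReal hp0.le] at this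
      exact this.ne
    have hfloc : ∀ N n x, IntegrableOn f (c N n x) volume := by
      intro N n x
      have : IsFiniteMeasure (volume.restrict (c N n x)) :=
        isFiniteMeasure_restrict.mpr ((hc N).measure_lt_top n x).ne
      exact (hf.restrict _).integrable (by simpa using hp.le)
    rw [eLpNorm_eq_lintegral_rpow_enorm_toReal hpne ENNReal.ofReal_ne_top,
      eLpNorm_eq_lintegral_rpow_enorm_toReal hpne ENNReal.ofReal_ne_top,
      ENNReal.toReal_ofReal hp0.le]
    have hmain : ∫⁻ x, ‖dyadicVariation Q r f x‖ₑ ^ p ≤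
        ENNReal.ofReal (2 ^ (p + 1) * (2 ^ (p + 2) * ((2 * R + 32) * (r / (r - 2)))) ^ p *
          (2 ^ p * (p / (p - 1)))) * ∫⁻ x, ‖f x‖ₑ ^ p := by
      calc ∫⁻ x, ‖dyadicVariation Q r f x‖ₑ ^ p
          ≤ ∫⁻ x, ⨆ N : ℕ, (seqVar r fun n => cellAvg volume (c N) f (min n (2 * N)) x) ^ p := by
            refine lintegral_mono_ae ?_
            filter_upwards [hsup r f] with x hx
            rw [enorm_eq_self, ← ENNReal.le_rpow_inv_iff hp0]
            refine hx.trans (iSup_le fun N => (ENNReal.le_rpow_inv_iff hp0).mpr ?_)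
            exact le_iSup (fun N : ℕ =>
              (seqVar r fun n => cellAvg volume (c N) f (min n (2 * N)) x) ^ p) N
        _ = ⨆ N : ℕ, ∫⁻ x, (seqVar r fun n => cellAvg volume (c N) f (min n (2 * N)) x) ^ p :=
            lintegral_iSup (fun N => ((hc N).measurable_seqVar_min f r (2 * N)).pow_const p)
              fun M N h x => ENNReal.rpow_le_rpow (hmono r f h x) hp0.le
        _ ≤ _ := iSup_le fun N =>
            (hc N).lintegral_seqVar_min_rpow_le hf.1 (hfloc N) hp hr hfp (2 * N)
    refine (ENNReal.rpow_le_rpow hmain (by positivity)).trans (le_of_eq ?_)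
    rw [ENNReal.mul_rpow_of_nonneg _ _ (by positivity),
      ENNReal.ofReal_rpow_of_pos (by positivity)]
    congr 2
    have hsplit : 2 ^ (p + 1) * (2 ^ (p + 2) * ((2 * R + 32) * (r / (r - 2)))) ^ p *
        (2 ^ p * (p / (p - 1))) = (2 ^ (p + 1) * (2 ^ p * (p / (p - 1)))) *
          (2 ^ (p + 2) * (2 * R + 32) * (r / (r - 2))) ^ p := by
      rw [← mul_assoc (2 ^ (p + 2)) (2 * R + 32)]
      ring
    rw [hsplit, Real.mul_rpow (by positivity) (by positivity),
      ← Real.rpow_mul (x := 2 ^ (p + 2) * (2 * R + 32) * (r / (r - 2))) (by positivity),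
      mul_one_div_cancel hp0.ne', Real.rpow_one]
    ring
  · intro r hr
    have hr2 : 0 < r - 2 := by linarith
    refine ⟨(2 * R + 32) * (r / (r - 2)), by positivity, fun f hf s hs => ?_⟩
    rw [eLpNorm_one_eq_lintegral_enorm]
    calc volume {x | ENNReal.ofReal s < dyadicVariation Q r f x}
        ≤ volume (⋃ N : ℕ, {x | ENNReal.ofReal s <
            seqVar r fun n => cellAvg volume (c N) f (min n (2 * N)) x}) := by
          refine measure_mono_ae ?_
          filter_upwards [hsup r f] with x hx hs
          exact Set.mem_iUnion.mpr (lt_iSup_iff.mp (lt_of_lt_of_le hs hx))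
      _ = ⨆ N : ℕ, volume {x | ENNReal.ofReal s <
            seqVar r fun n => cellAvg volume (c N) f (min n (2 * N)) x} :=
          Monotone.measure_iUnion fun M N h x hx => lt_of_lt_of_le hx (hmono r f h x)
      _ ≤ _ := by
          refine iSup_le fun N => le_trans (measure_mono fun x hx => ?_)
            ((hc N).measure_lt_seqVar_le (memLp_one_iff_integrable.mp hf) hr hs)
          exact lt_of_lt_of_le hx (seqVar_comp_le r (fun n => cellAvg volume (c N) f n x)
            fun m n h => min_le_min_right _ h)
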